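/- **Setting.** A library has $D\ge 1$ independent uniform messages, message $d$ having rate $R_d\ge 0$, i.e. $2^{nR_d}$ values at blocklength $n$ (rounded up if this is not an integer). There are $K$ receivers, receiver $k$ having a cache of size $M_k\ge 0$. The delivery channel is a memoryless broadcast channel with input alphabet $\{0,1\}^F$, $F\ge1$; receiver $k$ observes an erasure with probability $\delta_k$ and the transmitted packet otherwise, $1\ge\delta_1\ge\dots\ge\delta_K\ge0$, and the joint law across receivers is arbitrary. A set $\mathcal D\subseteq\{1,\dots,D\}^K$ of feasible demands is given. A code of blocklength $n$ consists of cache functions $g_k$ of the library with at most $2^{nM_k}$ values and, for each $\mathbf d\in\mathcal D$, an encoder $f_{\mathbf d}$ from the library to $n$ packets and decoders $\varphi_{k,\mathbf d}$ that estimate $W_{d_k}$ from the $n$ outputs of receiver $k$ and its cache content. Its error probability is the probability that some receiver errs for some $\mathbf d\in\mathcal D$ (given the library, the transmissions for different demands are independent). The tuple $(R_1,\dots,R_D,M_1,\dots,M_K)$ is *achievable* if for every $\epsilon>0$ there is, for all sufficiently large $n$, a code with error probability at most $\epsilon$. The *capacity-memory region* is the closure of the set of achievable tuples. **Proposition.**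 Let $1\le t\le K_0\le K$ be integers, $M\ge0$, $R\ge \frac{MK_0}{Dt}$, and let $a:=\frac{M}{D\binom{K_0-1}{t-1}}$. Let $\beta_1,\dots,\beta_K\ge 0$ with $\sum_k\beta_k=1$. Let $C_{k,\tilde k}\ge0$ ($1\le k\le K_0<\tilde k\le K$) be piggyback rates that can be taken from disjoint parts of the cached sub-messages: for some $P_{T,k,\tilde k}\ge0$, with $T$ ranging over the $t$-subsets of $\{1,\dots,K_0\}$, $$C_{k,\tilde k}=\sum_{T\ni k}P_{T,k,\tilde k},\qquad \sum_{k\in T}P_{T,k,\tilde k}\le a\quad\text{for all }T,\tilde k .$$ Suppose that the following $K+K_0$ inequalities hold. 1. For each $k\in\{1,\dots,K_0-t\}$, $$R\le \beta_kF(1-\delta_k)+a\Big(\tbinom{K_0}{t}-\tbinom{K_0-k}{t}\Big),\qquad R+\sum_{\tilde k=K_0+1}^{K}C_{k,\tilde k}\le \beta_kF(1-\delta_{k+1})+a\Big(\tbinom{K_0}{t}-\tbinom{K_0-k}{t}\Big).$$ 2. For each $k\in\{K_0-t+1,\dots,K_0\}$, $$R\le \beta_kF(1-\delta_k)+\frac{MK_0}{Dt},\qquad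 R+\sum_{\tilde k=K_0+1}^{K}C_{k,\tilde k}\le \beta_kF(1-\delta_{k+1})+\frac{MK_0}{Dt}$$ (the second inequality is dropped for $k=K_0=K$). 3. For each $k\in\{K_0+1,\dots,K\}$, $$R-\sum_{k'=1}^{K_0}C_{k',k}\le\beta_kF(1-\delta_k).$$ Then, with all message rates equal to $R$, cache size $M$ at receivers $1,\dots,K_0$ and $0$ at the others, the rate-memory tuple $(R,\dots,R,M,\dots,M,0,\dots,0)$ lies in the capacity-memory region. Moreover $(R',\dots,R',M,\dots,M,0,\dots,0)$ is achievable for every $0\le R'<R$, and $(R,\dots,R,M,\dots,M,0,\dots,0)$ itself is achievable if the inequalities in 1–3 are all strict. -/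

import Mathlib

open Filter

/-- The channel input alphabet: packets of `F` bits. -/
abbrev Packet (F : ℕ) : Type := Fin F → Bool

/-- The channel output alphabet: a packet, or the erasure symbol `none`. -/
abbrev Output (F : ℕ) : Type := Option (Packet F)

open Classical in
/-- `Q x y` is the probability that the `K` receivers observe `y` when the packet `x` is sent.
`Q` is any broadcast law (arbitrarily correlated across receivers) for which receiver `k` sees an
erasure with probability `δ k`, and the packet `x` itself otherwise. -/
structure IsErasureBC {K F : ℕ} (δ : Fin K → ℝ) (Q : Packet F → (Fin K → Output F) → ℝ) :
    Prop where
  nonneg : ∀ x y, 0 ≤ Q x y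
  sum_eq_one : ∀ x, ∑ y, Q x y = 1
  marginal : ∀ (x : Packet F) (k : Fin K) (b : Output F),
    ∑ y ∈ Finset.univ.filter (fun y : Fin K → Output F => y k = b), Q x y =
      if b = some x then 1 - δ k else if b = none then δ k else 0

/-- Values of a message of rate `r` at blocklength `n`: a set of size `2 ^ (n r)`, rounded up
when this is not an integer. -/
abbrev Message (n : ℕ) (r : ℝ) : Type := Fin ⌈(2 : ℝ) ^ ((n : ℝ) * r)⌉₊

/-- Values of the whole library `(W_1, …, W_D)`. -/
abbrev Library (n : ℕ) {D : ℕ} (R : Fin D → ℝ) : Type := (d : Fin D) → Message n (R d)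

/-- A code of blocklength `n` for the feasible demand set `𝒟`, with message rates `R` and
cache sizes `M`: cache functions, and an encoder and decoders for each feasible demand. -/
structure CachingCode {K D : ℕ} (F n : ℕ) (𝒟 : Finset (Fin K → Fin D))
    (R : Fin D → ℝ) (M : Fin K → ℝ) where
  /-- number of values of the cache content of each receiver -/
  cacheCard : Fin K → ℕ
  cacheCard_le : ∀ k, (cacheCard k : ℝ) ≤ (2 : ℝ) ^ ((n : ℝ) * M k)
  /-- caching functions -/
  cache : (k : Fin K) → Library n R → Fin (cacheCard k)
  /-- encoders of the delivery phase -/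
  encode : (d : 𝒟) → Library n R → Fin n → Packet F
  /-- decoders of the delivery phase -/
  decode : (k : Fin K) → (d : 𝒟) → (Fin n → Output F) → Fin (cacheCard k) →
    Message n (R (d.1 k))

open Classical in
/-- The probability that some receiver errs for some feasible demand. The library is uniform;
given the library, the transmissions for the different demands use the memoryless channel `Q`
independently. -/
noncomputable def CachingCode.errorProb {K D F n : ℕ} {𝒟 : Finset (Fin K → Fin D)}
    {R : Fin D → ℝ} {M : Fin K → ℝ} (c : CachingCode F n 𝒟 R M)
    (Q : Packet F → (Fin K → Output F) → ℝ) : ℝ :=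
  (∑ w : Library n R, ∑ y : 𝒟 → Fin n → Fin K → Output F,
    if ∃ (d : 𝒟) (k : Fin K), c.decode k d (fun i => y d i k) (c.cache k w) ≠ w (d.1 k)
    then ∏ d : 𝒟, ∏ i : Fin n, Q (c.encode d w i) (y d i) else 0) /
    (Fintype.card (Library n R) : ℝ)

/-- Achievability of the rate-memory tuple `(R_1, …, R_D, M_1, …, M_K)`. -/
def Achievable {K D F : ℕ} (Q : Packet F → (Fin K → Output F) → ℝ)
    (𝒟 : Finset (Fin K → Fin D)) (R : Fin D → ℝ) (M : Fin K → ℝ) : Prop :=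
  (∀ d, 0 ≤ R d) ∧ (∀ k, 0 ≤ M k) ∧
    ∀ ε : ℝ, 0 < ε → ∀ᶠ n : ℕ in atTop, ∃ c : CachingCode F n 𝒟 R M, c.errorProb Q ≤ ε

/-- The capacity-memory region: the closure of the set of achievable rate-memory tuples. -/
def capacityMemoryRegion {K D F : ℕ} (Q : Packet F → (Fin K → Output F) → ℝ)
    (𝒟 : Finset (Fin K → Fin D)) : Set ((Fin D → ℝ) × (Fin K → ℝ)) :=
  closure {p | Achievable Q 𝒟 p.1 p.2}

/-- Cache sizes: `M` at the `K₀` weakest (first) receivers, none at the others. -/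
noncomputable def weakCaches (K K₀ : ℕ) (M : ℝ) : Fin K → ℝ :=
  fun k => if (k : ℕ) < K₀ then M else 0

/-- The rate `M / (D * binom (K₀ - 1) (t - 1))` of each cached sub-message `W_d^(T)`, where `T`
ranges over the `t`-subsets of the `K₀` weakest receivers. -/
noncomputable def subRate (D K₀ t : ℕ) (M : ℝ) : ℝ :=
  M / ((D : ℝ) * ((K₀ - 1).choose (t - 1) : ℝ))

/-- The `t`-subsets of the `K₀` weakest receivers. -/
def cacheSets (K K₀ t : ℕ) : Finset (Finset (Fin K)) :=
  (Finset.univ.filter (fun k : Fin K => (k : ℕ) < K₀)).powersetCard t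

/-- `C k l` is a possible rate of bits of receiver `l`'s message, taken from the sub-messages
cached at receiver `k`, that are piggybacked in phase `k` (`k` among the `K₀` weakest receivers,
`l` among the others). `P T k l` is the rate taken from the sub-message with index set `T`; the
bits of one sub-message used in different phases are different, so that their total rate does not
exceed the rate `a` of the sub-message. -/
def IsPiggybackRates {K : ℕ} (K₀ t : ℕ) (a : ℝ) (C : Fin K → Fin K → ℝ) : Prop :=
  ∃ P : Finset (Fin K) → Fin K → Fin K → ℝ,
    (∀ T k l, 0 ≤ P T k l) ∧
    (∀ T ∈ cacheSets K K₀ t, ∀ l : Fin K, K₀ ≤ (l : ℕ) → ∑ k ∈ T, P T k l ≤ a) ∧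
    (∀ k l : Fin K, (k : ℕ) < K₀ → K₀ ≤ (l : ℕ) →
      C k l = ∑ T ∈ (cacheSets K K₀ t).filter (fun T => k ∈ T), P T k l)

/-- The inequalities of the scheme, with `rel` being `≤` or `<`. The element `k : Fin K` is
receiver number `k + 1`. When all receivers have caches, the strongest receiver has no successor
and the fourth condition does not apply to it. -/
structure SchemeConditions {K : ℕ} (rel : ℝ → ℝ → Prop) (D F K₀ t : ℕ) (δ : Fin K → ℝ)
    (R M : ℝ) (β : Fin K → ℝ) (C : Fin K → Fin K → ℝ) : Prop where
  cond1 : ∀ k : Fin K, (k : ℕ) + 1 + t ≤ K₀ →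
    rel R (β k * (F * (1 - δ k)) +
      subRate D K₀ t M * ((K₀.choose t : ℝ) - ((K₀ - ((k : ℕ) + 1)).choose t : ℝ)))
  cond2 : ∀ k k' : Fin K, (k : ℕ) + 1 + t ≤ K₀ → (k' : ℕ) = (k : ℕ) + 1 →
    rel (R + ∑ l ∈ Finset.univ.filter (fun l : Fin K => K₀ ≤ (l : ℕ)), C k l)
      (β k * (F * (1 - δ k')) +
        subRate D K₀ t M * ((K₀.choose t : ℝ) - ((K₀ - ((k : ℕ) + 1)).choose t : ℝ)))
  cond3 : ∀ k : Fin K, K₀ < (k : ℕ) + 1 + t → (k : ℕ) < K₀ →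
    rel R (β k * (F * (1 - δ k)) + M * K₀ / (D * t))
  cond4 : ∀ k k' : Fin K, K₀ < (k : ℕ) + 1 + t → (k : ℕ) < K₀ → (k' : ℕ) = (k : ℕ) + 1 →
    rel (R + ∑ l ∈ Finset.univ.filter (fun l : Fin K => K₀ ≤ (l : ℕ)), C k l)
      (β k * (F * (1 - δ k')) + M * K₀ / (D * t))
  cond5 : ∀ l : Fin K, K₀ ≤ (l : ℕ) →
    rel (R - ∑ k ∈ Finset.univ.filter (fun k : Fin K => (k : ℕ) < K₀), C k l)
      (β l * (F * (1 - δ l)))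

/-! Each message is cut into `K₀.choose t` sub-messages of rate `a = subRate D K₀ t M`, one for each
`t`-subset `T` of the weak receivers and cached by the members of `T`, and an uncached rest.
Delivery has one phase per receiver, phase `k` taking the fraction `β k` of the time. A weak phase
`k` carries the uncached rest for receiver `k`, one sum of sub-messages for each `t`-subset of the
later weak receivers, and piggybacked bits for strong receivers. These bits come from sub-messages
cached at `k`, so they cost `k` nothing; every later receiver must decode them, the worst being `k +
1`. Hence two inequalities per weak phase. A strong phase carries the uncached rest and the bits
that were not piggybacked.

Weak receivers recover their sub-messages from the sums and their caches
(`subMessage_eq_of_codedPacket_eq`), strong ones by collecting parts (`exists_piggyback_code`). The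
phases are coded at random (`exists_phase_code`); the error is at most a sum over needed phases of
the chance that a wrong phase message survives, which vanishes below capacity
(`HasRate.exists_tendsto`). Scaling all rates by `θ < 1` makes the inequalities strict, except in
phases of rate zero, where nothing has to be decoded. This gives all `R' < R` (`achievable_of_lt`),
hence the closure; strict conditions persist for a slightly larger `R`. -/

/-! ### Receiver output laws and random codebooks. -/

/-- The fibres of a coordinatewise map are product sets, so a product law is pushed forward to the
product of the one-letter laws. -/
theorem sum_comp_mul_prod {ι α β : Type*} [Fintype ι] [DecidableEq ι] [Fintype α] [Fintype β]
    [DecidableEq β] (u : ι → α → ℝ) (f : ι → α → β) (G : (ι → β) → ℝ) :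
    ∑ y : ι → α, G (fun i => f i (y i)) * ∏ i, u i (y i) =
      ∑ z : ι → β, G z * ∏ i, ∑ a ∈ Finset.univ.filter (fun a => f i a = z i), u i a := by
  classical
  rw [← Finset.sum_fiberwise Finset.univ (fun (y : ι → α) i => f i (y i))]
  refine Finset.sum_congr rfl fun z _ => ?_
  rw [Finset.prod_univ_sum, Finset.mul_sum]
  have hs : Finset.univ.filter (fun y : ι → α => (fun i => f i (y i)) = z) =
      Fintype.piFinset fun i => Finset.univ.filter (fun a => f i a = z i) := by
    ext y; simp [funext_iff]
  rw [← hs]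
  refine Finset.sum_congr rfl fun y hy => ?_
  rw [(Finset.mem_filter.mp hy).2]

/-- The law of the outputs of one receiver: the packets are erased independently. -/
theorem IsErasureBC.sum_receiver {K F n : ℕ} {δ : Fin K → ℝ}
    {Q : Packet F → (Fin K → Output F) → ℝ} (hQ : IsErasureBC δ Q) (x : Fin n → Packet F)
    (j : Fin K) (G : (Fin n → Output F) → ℝ) :
    ∑ y : Fin n → Fin K → Output F, G (fun i => y i j) * ∏ i, Q (x i) (y i) =
      ∑ e : Fin n → Bool, G (fun i => if e i then some (x i) else none) *
        ∏ i, (if e i then 1 - δ j else δ j) := by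
  classical
  -- Both sides become sums over output words of receiver `j`, compared letter by letter. Only the
  -- marginal of `Q` enters, so correlation across receivers is irrelevant.
  have h1 := sum_comp_mul_prod (fun i => Q (x i)) (fun (_ : Fin n) y => y j) G
  have h2 := sum_comp_mul_prod (fun (_ : Fin n) (e : Bool) => if e then 1 - δ j else δ j)
    (fun i (e : Bool) => if e then some (x i) else none) G
  rw [h1, h2]
  refine Finset.sum_congr rfl fun z _ => ?_
  congr 1
  refine Finset.prod_congr rfl fun i _ => ?_
  have h3 := hQ.marginal (x i) j (z i)
  convert h3 using 1
  rw [Finset.sum_filter]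
  rcases hz : z i with _ | b
  · simp
  · by_cases hb : b = x i
    · simp [hb]
    · have hb' : ¬ x i = b := fun h => hb h.symm
      simp [hb, hb']

theorem IsErasureBC.sum_eq_one' {K F n : ℕ} {δ : Fin K → ℝ}
    {Q : Packet F → (Fin K → Output F) → ℝ} (hQ : IsErasureBC δ Q) (x : Fin n → Packet F) :
    ∑ y : Fin n → Fin K → Output F, ∏ i, Q (x i) (y i) = 1 := by
  classical
  have h := Finset.prod_univ_sum (fun _ : Fin n => (Finset.univ : Finset (Fin K → Output F)))
    (fun i y => Q (x i) y)
  rw [Fintype.piFinset_univ] at h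
  rw [← h]
  exact Finset.prod_eq_one fun i _ => hQ.sum_eq_one _

/-- When `f a = f a'`, the value at `a` can be overwritten by any element of `V` and still be
recovered from `a'`. -/
theorem card_filter_eq_mul_card_le {X V : Type*} [Fintype X] [DecidableEq X] [Fintype V]
    [DecidableEq V] {a a' : X} (h : a ≠ a') :
    (Finset.univ.filter (fun f : X → V => f a = f a')).card * Fintype.card V ≤
      Fintype.card (X → V) := by
  rw [← Finset.card_univ (α := V), ← Finset.card_product, ← Finset.card_univ (α := X → V)]
  refine Finset.card_le_card_of_injOn (fun p => Function.update p.1 a p.2)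
    (fun _ _ => Finset.mem_coe.mpr (Finset.mem_univ _)) ?_
  rintro ⟨f, v⟩ hf ⟨g, u⟩ hg hfg
  simp only [Finset.coe_product, Set.mem_prod, Finset.mem_coe, Finset.mem_filter,
    Finset.mem_univ, true_and, and_true] at hf hg hfg
  have hv : v = u := by simpa using congrFun hfg a
  have hne : ∀ x, x ≠ a → f x = g x := fun x hx => by
    simpa [Function.update_of_ne hx] using congrFun hfg x
  have : f = g := by
    ext x
    by_cases hx : x = a
    · rw [hx, hf, hg, hne _ h.symm]
    · exact hne x hx
  rw [this, hv]

/-- In a random codebook, two codewords agree at the positions in `I` with probability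
`|V| ^ (-|I|)`. -/
theorem card_codebook_agree_le {ι X V : Type*} [Fintype ι] [DecidableEq ι] [Fintype X]
    [DecidableEq X] [Fintype V] [Nonempty V] [DecidableEq V] {a a' : X} (h : a ≠ a')
    (I : Finset ι) :
    ((Finset.univ.filter (fun c : ι → X → V => ∀ i ∈ I, c i a = c i a')).card : ℝ) ≤
      Fintype.card (ι → X → V) * ((Fintype.card V : ℝ)⁻¹) ^ I.card := by
  have hs : Finset.univ.filter (fun c : ι → X → V => ∀ i ∈ I, c i a = c i a') =
      Fintype.piFinset fun i => if i ∈ I then Finset.univ.filter (fun f : X → V => f a = f a')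
        else Finset.univ := by
    ext c
    simp only [Finset.mem_filter, Finset.mem_univ, true_and, Fintype.mem_piFinset]
    refine forall_congr' fun i => ?_
    by_cases hi : i ∈ I <;> simp [hi]
  have hV : (0 : ℝ) < Fintype.card V := by exact_mod_cast Fintype.card_pos
  have hI : ((Fintype.card V : ℝ)⁻¹) ^ I.card =
      ∏ i, if i ∈ I then ((Fintype.card V : ℝ)⁻¹) else 1 := by
    simp [Finset.prod_ite_mem]
  have hc : (Fintype.card (ι → X → V) : ℝ) = ∏ _i : ι, (Fintype.card (X → V) : ℝ) := by
    rw [Fintype.card_fun (α := ι)]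
    push_cast
    simp
  rw [hs, Fintype.card_piFinset, hI, hc, ← Finset.prod_mul_distrib]
  push_cast
  refine Finset.prod_le_prod (fun _ _ => by positivity) fun i _ => ?_
  by_cases hi : i ∈ I
  · simp only [hi, if_true]
    rw [← div_eq_mul_inv, le_div_iff₀ hV]
    exact_mod_cast card_filter_eq_mul_card_le h
  · simp [hi]

/-- Gallager's device: the union bound capped at 1 is replaced by a power, which is multiplicative
in the received packets and so can be averaged over the erasures. -/
theorem min_one_le_rpow {x s : ℝ} (hx : 0 ≤ x) (hs : 0 < s) (hs1 : s ≤ 1) : min 1 x ≤ x ^ s := by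
  rcases le_total x 1 with h | h
  · rw [min_eq_right h]
    rcases hx.eq_or_lt with h0 | h0
    · rw [← h0]; exact Real.rpow_nonneg le_rfl _
    · simpa using Real.rpow_le_rpow_of_exponent_ge h0 h hs1
  · rw [min_eq_left h]
    exact Real.one_le_rpow h hs.le

/-- In a random codebook, some wrong codeword agrees with the codeword of `a` at the positions in
`I` with probability at most `(N |V| ^ (-|I|)) ^ s`, where `N` is the number of wrong codewords. -/
theorem card_codebook_confused_le {ι X V : Type*} [Fintype ι] [DecidableEq ι] [Fintype X]
    [DecidableEq X] [Fintype V] [Nonempty V] [DecidableEq V] (a : X) (L : Finset X)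
    (hL : a ∉ L) (I : Finset ι) {s : ℝ} (hs : 0 < s) (hs1 : s ≤ 1) :
    ((Finset.univ.filter
      (fun c : ι → X → V => ∃ a' ∈ L, ∀ i ∈ I, c i a = c i a')).card : ℝ) ≤
      Fintype.card (ι → X → V) * ((L.card : ℝ) * ((Fintype.card V : ℝ)⁻¹) ^ I.card) ^ s := by
  have hx : 0 ≤ (L.card : ℝ) * ((Fintype.card V : ℝ)⁻¹) ^ I.card := by positivity
  refine le_trans ?_ (mul_le_mul_of_nonneg_left (min_one_le_rpow hx hs hs1) (by positivity))
  rw [mul_min_of_nonneg _ _ (by positivity), mul_one]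
  refine le_min (by exact_mod_cast Finset.card_le_univ _) ?_
  have hsub : Finset.univ.filter (fun c : ι → X → V => ∃ a' ∈ L, ∀ i ∈ I, c i a = c i a') ⊆
      L.biUnion fun a' => Finset.univ.filter (fun c : ι → X → V => ∀ i ∈ I, c i a = c i a') := by
    intro c hc
    simpa using hc
  calc ((Finset.univ.filter
      (fun c : ι → X → V => ∃ a' ∈ L, ∀ i ∈ I, c i a = c i a')).card : ℝ)
      ≤ ∑ a' ∈ L, ((Finset.univ.filter
          (fun c : ι → X → V => ∀ i ∈ I, c i a = c i a')).card : ℝ) := by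
        exact_mod_cast (Finset.card_le_card hsub).trans Finset.card_biUnion_le
    _ ≤ ∑ a' ∈ L, Fintype.card (ι → X → V) * ((Fintype.card V : ℝ)⁻¹) ^ I.card :=
        Finset.sum_le_sum fun a' ha' =>
          card_codebook_agree_le (by rintro rfl; exact hL ha') I
    _ = _ := by rw [Finset.sum_const, nsmul_eq_mul]; ring

theorem inv_card_packet_pow_rpow {F c : ℕ} (s : ℝ) :
    (((Fintype.card (Packet F) : ℝ)⁻¹) ^ c) ^ s = ((2 : ℝ) ^ (-((F : ℝ) * s))) ^ c := by
  have h : (Fintype.card (Packet F) : ℝ) = (2 : ℝ) ^ (F : ℝ) := by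
    simp [Packet]
  rw [h, ← Real.rpow_neg (by norm_num), ← Real.rpow_natCast, ← Real.rpow_natCast,
    ← Real.rpow_mul (by norm_num), ← Real.rpow_mul (by norm_num), ← Real.rpow_mul (by norm_num)]
  congr 1
  ring

/-- The average over the erasures of the factor `b` for every packet received in the set `I`. -/
theorem sum_erasures_pow {n : ℕ} (I : Finset (Fin n)) (d b : ℝ) :
    ∑ e : Fin n → Bool, b ^ (I.filter (fun i => e i = true)).card *
      ∏ i, (if e i then 1 - d else d) = (d + (1 - d) * b) ^ I.card := by
  classical
  have h := Finset.prod_univ_sum (fun _ : Fin n => (Finset.univ : Finset Bool))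
    (fun i e => (if i ∈ I ∧ e = true then b else 1) * (if e then 1 - d else d))
  rw [Fintype.piFinset_univ] at h
  have h1 : ∀ e : Fin n → Bool, b ^ (I.filter (fun i => e i = true)).card =
      ∏ i, if i ∈ I ∧ e i = true then b else 1 := by
    intro e
    rw [← Finset.prod_const, ← Finset.prod_filter]
    congr 1
    ext i
    simp
  simp_rw [h1, ← Finset.prod_mul_distrib]
  rw [← h, ← Finset.prod_const]
  have h2 : ∀ i : Fin n, ∑ e : Bool, (if i ∈ I ∧ e = true then b else 1) *
      (if e then 1 - d else d) = if i ∈ I then d + (1 - d) * b else 1 := by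
    intro i
    by_cases hi : i ∈ I
    · simp only [hi, true_and, Fintype.sum_bool, if_true, Bool.false_eq_true, if_false]
      ring
    · simp [hi]
  simp_rw [h2]
  rw [Finset.prod_ite_mem, Finset.univ_inter]

/-! ### Random coding in phases. -/

open Classical in
/-- Random coding in phases. The packet sent at time `i` is a function of `m (ph i) w`, drawn at
random, and receiver `j` looks for a message vector consistent with what it knows. -/
theorem IsErasureBC.exists_phase_code_of_fintype {K F n : ℕ} {δ : Fin K → ℝ}
    {Q : Packet F → (Fin K → Output F) → ℝ} (hQ : IsErasureBC δ Q)
    (hδ0 : ∀ k, 0 ≤ δ k) (hδ1 : ∀ k, δ k ≤ 1)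
    {W X κ : Type} [Fintype W] [Nonempty W] [Fintype X] [Fintype κ] [DecidableEq κ]
    (ph : Fin n → κ) (m : κ → W → X) {S G : Fin K → Type}
    (side : ∀ j, W → S j) (g : ∀ j, W → G j) (need : Fin K → Finset κ)
    (hdet : ∀ j w w', side j w = side j w' → (∀ k ∈ need j, m k w = m k w') → g j w = g j w')
    (v : Fin K → κ → ℕ)
    (hv : ∀ j, ∀ k ∈ need j, ∀ w,
      ((Finset.univ.filter (fun w' => side j w' = side j w)).image (m k)).card ≤ v j k)
    (s : Fin K → κ → ℝ) (hs : ∀ j k, 0 < s j k) (hs1 : ∀ j k, s j k ≤ 1) :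
    ∃ (enc : W → Fin n → Packet F) (dec : ∀ j, (Fin n → Output F) → S j → G j),
      ∑ w, ∑ y : Fin n → Fin K → Output F,
        (if ∃ j, dec j (fun i => y i j) (side j w) ≠ g j w then ∏ i, Q (enc w i) (y i) else 0) ≤
      Fintype.card W * ∑ j, ∑ k ∈ need j, ((v j k - 1 : ℕ) : ℝ) ^ s j k *
        (δ j + (1 - δ j) * (2 : ℝ) ^ (-((F : ℝ) * s j k))) ^
          (Finset.univ.filter (fun i => ph i = k)).card := by
  have w₀ : W := Classical.arbitrary W
  -- Any consistent candidate is accepted. The default `g j w₀` never matters, since the true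
  -- library is always consistent with its own outputs.
  let dec : (Fin n → X → Packet F) → ∀ j, (Fin n → Output F) → S j → G j := fun c j z σ =>
    if h : ∃ w', side j w' = σ ∧ ∀ i, ph i ∈ need j → z i = none ∨ z i = some (c i (m (ph i) w'))
    then g j h.choose else g j w₀
  let alt : Fin K → κ → W → Finset X := fun j k w =>
    ((Finset.univ.filter (fun w' => side j w' = side j w)).image (m k)).erase (m k w)
  let I : κ → (Fin n → Bool) → Finset (Fin n) := fun k e =>
    (Finset.univ.filter (fun i => ph i = k)).filter (fun i => e i = true)
  let bad : (Fin n → X → Packet F) → Fin K → κ → W → (Fin n → Bool) → Prop := fun c j k w e =>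
    ∃ a' ∈ alt j k w, ∀ i ∈ I k e, c i (m k w) = c i a'
  let p : Fin K → (Fin n → Bool) → ℝ := fun j e => ∏ i, (if e i then 1 - δ j else δ j)
  have hp : ∀ j e, 0 ≤ p j e := fun j e => Finset.prod_nonneg fun i _ => by
    split_ifs
    · linarith [hδ1 j]
    · exact hδ0 j
  -- If the accepted candidate gives a wrong answer, `hdet` yields a needed phase in which its
  -- message differs from the true one. Confusion thus occurs within a single phase, and no joint
  -- event over several phases has to be bounded.
  have hbad : ∀ c j w e, dec c j
      (fun i => if e i then some (c i (m (ph i) w)) else none) (side j w) ≠ g j w →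
      ∃ k ∈ need j, bad c j k w e := by
    intro c j w e hne
    have hex : ∃ w', side j w' = side j w ∧ ∀ i, ph i ∈ need j →
        (if e i then some (c i (m (ph i) w)) else none) = none ∨
        (if e i then some (c i (m (ph i) w)) else none) = some (c i (m (ph i) w')) := by
      refine ⟨w, rfl, fun i _ => ?_⟩
      by_cases he : e i <;> simp [he]
    have hd : dec c j (fun i => if e i then some (c i (m (ph i) w)) else none) (side j w) =
        g j hex.choose := dif_pos hex
    obtain ⟨h1, h2⟩ := hex.choose_spec
    rw [hd] at hne
    generalize hex.choose = w' at h1 h2 hne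
    by_contra hno
    push Not at hno
    refine hne (hdet j w' w h1 fun k hk => ?_)
    by_contra hmk
    refine hno k hk ⟨m k w', ?_, ?_⟩
    · simp only [alt, Finset.mem_erase]
      exact ⟨hmk, Finset.mem_image_of_mem _ (by simpa using h1)⟩
    · intro i hi
      simp only [I, Finset.mem_filter, Finset.mem_univ, true_and] at hi
      obtain ⟨rfl, he⟩ := hi
      simpa [he] using h2 i hk
  have hcount : ∀ j, ∀ k ∈ need j, ∀ w e,
      ∑ c : Fin n → X → Packet F, (if bad c j k w e then (1 : ℝ) else 0) ≤
      Fintype.card (Fin n → X → Packet F) *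
        (((v j k - 1 : ℕ) : ℝ) ^ s j k * ((2 : ℝ) ^ (-((F : ℝ) * s j k))) ^ (I k e).card) := by
    intro j k hk w e
    have h1 := card_codebook_confused_le (ι := Fin n) (V := Packet F) (m k w) (alt j k w)
      (Finset.notMem_erase _ _) (I k e) (hs j k) (hs1 j k)
    rw [Finset.sum_boole]
    rw [Real.mul_rpow (by positivity) (by positivity), inv_card_packet_pow_rpow] at h1
    refine le_trans (le_of_eq ?_) (h1.trans ?_)
    · congr!
    · refine mul_le_mul_of_nonneg_left (mul_le_mul_of_nonneg_right ?_ (by positivity))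
        (by positivity)
      refine Real.rpow_le_rpow (by positivity) ?_ (hs j k).le
      -- The true message is one of the at most `v j k` candidates, whence the `- 1`. It makes the
      -- bound zero when the phase message is already known.
      have h3 : m k w ∈ (Finset.univ.filter (fun w' => side j w' = side j w)).image (m k) :=
        Finset.mem_image_of_mem _ (by simp)
      have h4 := hv j k hk w
      simp only [alt, Finset.card_erase_of_mem h3]
      exact_mod_cast Nat.sub_le_sub_right h4 1
  have hc : ∀ c : Fin n → X → Packet F, ∑ w, ∑ y : Fin n → Fin K → Output F,
      (if ∃ j, dec c j (fun i => y i j) (side j w) ≠ g j w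
        then ∏ i, Q (c i (m (ph i) w)) (y i) else 0) ≤
      ∑ w, ∑ j, ∑ k ∈ need j, ∑ e, (if bad c j k w e then (1 : ℝ) else 0) * p j e := by
    intro c
    refine Finset.sum_le_sum fun w _ => ?_
    calc _ ≤ ∑ y : Fin n → Fin K → Output F, ∑ j,
          (if dec c j (fun i => y i j) (side j w) ≠ g j w then (1 : ℝ) else 0) *
            ∏ i, Q (c i (m (ph i) w)) (y i) := by
          refine Finset.sum_le_sum fun y _ => ?_
          have hq : 0 ≤ ∏ i, Q (c i (m (ph i) w)) (y i) :=
            Finset.prod_nonneg fun i _ => hQ.nonneg _ _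
          rw [← Finset.sum_mul]
          split_ifs with h
          · obtain ⟨j, hj⟩ := h
            refine le_mul_of_one_le_left hq ?_
            refine le_trans ?_ (Finset.single_le_sum (fun j _ => by positivity)
              (Finset.mem_univ j))
            rw [if_pos hj]
          · positivity
      _ = ∑ j, ∑ e, (if dec c j (fun i => if e i then some (c i (m (ph i) w)) else none)
            (side j w) ≠ g j w then (1 : ℝ) else 0) * p j e := by
          rw [Finset.sum_comm]
          refine Finset.sum_congr rfl fun j _ => ?_
          exact hQ.sum_receiver (fun i => c i (m (ph i) w)) j
            (fun z => if dec c j z (side j w) ≠ g j w then (1 : ℝ) else 0)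
      _ ≤ ∑ j, ∑ e, ∑ k ∈ need j, (if bad c j k w e then (1 : ℝ) else 0) * p j e := by
          refine Finset.sum_le_sum fun j _ => Finset.sum_le_sum fun e _ => ?_
          rw [← Finset.sum_mul]
          refine mul_le_mul_of_nonneg_right ?_ (hp j e)
          split_ifs with h
          · obtain ⟨k, hk, hb⟩ := hbad c j w e h
            refine le_trans ?_ (Finset.single_le_sum (fun k _ => by positivity) hk)
            rw [if_pos hb]
          · positivity
      _ = _ := Finset.sum_congr rfl fun j _ => Finset.sum_comm
  -- Some codebook does no worse than the average over all codebooks.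
  suffices h : ∃ c ∈ (Finset.univ : Finset (Fin n → X → Packet F)),
      ∑ w, ∑ j, ∑ k ∈ need j, ∑ e, (if bad c j k w e then (1 : ℝ) else 0) * p j e ≤
      Fintype.card W * ∑ j, ∑ k ∈ need j, ((v j k - 1 : ℕ) : ℝ) ^ s j k *
        (δ j + (1 - δ j) * (2 : ℝ) ^ (-((F : ℝ) * s j k))) ^
          (Finset.univ.filter (fun i => ph i = k)).card by
    obtain ⟨c, -, h⟩ := h
    exact ⟨fun w i => c i (m (ph i) w), dec c, (hc c).trans h⟩
  refine Finset.exists_le_of_sum_le ⟨fun _ _ _ => false, Finset.mem_univ _⟩ ?_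
  rw [Finset.sum_const, nsmul_eq_mul, Finset.card_univ, Finset.sum_comm]
  calc _ ≤ ∑ _w : W, (Fintype.card (Fin n → X → Packet F) : ℝ) * ∑ j, ∑ k ∈ need j,
        ((v j k - 1 : ℕ) : ℝ) ^ s j k *
        (δ j + (1 - δ j) * (2 : ℝ) ^ (-((F : ℝ) * s j k))) ^
          (Finset.univ.filter (fun i => ph i = k)).card := by
        refine Finset.sum_le_sum fun w _ => ?_
        rw [Finset.sum_comm, Finset.mul_sum]
        refine Finset.sum_le_sum fun j _ => ?_
        rw [Finset.sum_comm, Finset.mul_sum]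
        refine Finset.sum_le_sum fun k hk => ?_
        rw [Finset.sum_comm, ← sum_erasures_pow, Finset.mul_sum, Finset.mul_sum]
        refine Finset.sum_le_sum fun e _ => ?_
        rw [← Finset.sum_mul, ← mul_assoc, ← mul_assoc]
        refine mul_le_mul_of_nonneg_right ((hcount j k hk w e).trans (le_of_eq ?_)) (hp j e)
        rw [mul_assoc]
    _ = _ := by
        rw [Finset.sum_const, nsmul_eq_mul, Finset.card_univ]
        ring

open Classical in
/-- Random coding in phases, with phase messages in an arbitrary type. -/
theorem IsErasureBC.exists_phase_code {K F n : ℕ} {δ : Fin K → ℝ}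
    {Q : Packet F → (Fin K → Output F) → ℝ} (hQ : IsErasureBC δ Q)
    (hδ0 : ∀ k, 0 ≤ δ k) (hδ1 : ∀ k, δ k ≤ 1)
    {W X κ : Type} [Fintype W] [Nonempty W] [Fintype κ] [DecidableEq κ]
    (ph : Fin n → κ) (m : κ → W → X) {S G : Fin K → Type}
    (side : ∀ j, W → S j) (g : ∀ j, W → G j) (need : Fin K → Finset κ)
    (hdet : ∀ j w w', side j w = side j w' → (∀ k ∈ need j, m k w = m k w') → g j w = g j w')
    (v : Fin K → κ → ℕ)
    (hv : ∀ j, ∀ k ∈ need j, ∀ w, ∀ L : Finset X,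
      (∀ x ∈ L, ∃ w', side j w' = side j w ∧ m k w' = x) → L.card ≤ v j k)
    (s : Fin K → κ → ℝ) (hs : ∀ j k, 0 < s j k) (hs1 : ∀ j k, s j k ≤ 1) :
    ∃ (enc : W → Fin n → Packet F) (dec : ∀ j, (Fin n → Output F) → S j → G j),
      ∑ w, ∑ y : Fin n → Fin K → Output F,
        (if ∃ j, dec j (fun i => y i j) (side j w) ≠ g j w then ∏ i, Q (enc w i) (y i) else 0) ≤
      Fintype.card W * ∑ j, ∑ k ∈ need j, ((v j k - 1 : ℕ) : ℝ) ^ s j k *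
        (δ j + (1 - δ j) * (2 : ℝ) ^ (-((F : ℝ) * s j k))) ^
          (Finset.univ.filter (fun i => ph i = k)).card := by
  have : Fintype (Set.range fun p : κ × W => m p.1 p.2) := Fintype.ofFinite _
  let m' : κ → W → Set.range (fun p : κ × W => m p.1 p.2) := fun k w => ⟨m k w, (k, w), rfl⟩
  refine hQ.exists_phase_code_of_fintype hδ0 hδ1 ph m' side g need
    (fun j w w' h hk => hdet j w w' h fun k hk' => congrArg Subtype.val (hk k hk'))
    v (fun j k hk w => ?_) s hs hs1
  refine (Finset.card_image_of_injective _ Subtype.val_injective).symm.trans_le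
    (hv j k hk w _ fun x hx => ?_)
  simp only [Finset.mem_image, Finset.mem_filter, Finset.mem_univ, true_and] at hx
  obtain ⟨-, ⟨w', hw', rfl⟩, rfl⟩ := hx
  exact ⟨w', hw', rfl⟩

/-! ### Rates, error exponent and rounding. -/

/-- `v n` is at most of the order of `2 ^ (n r)`, and is trivial when `r = 0`. -/
structure HasRate (v : ℕ → ℕ) (r : ℝ) : Prop where
  nonneg : 0 ≤ r
  bound : ∃ c : ℝ, ∀ n, (v n : ℝ) ≤ c * (2 : ℝ) ^ ((n : ℝ) * r)
  trivial : r = 0 → ∀ n, v n ≤ 1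

theorem HasRate.one : HasRate (fun _ => 1) 0 :=
  ⟨le_rfl, ⟨1, fun n => by simp⟩, fun _ _ => le_rfl⟩

theorem HasRate.mul {v u : ℕ → ℕ} {r q : ℝ} (hv : HasRate v r) (hu : HasRate u q) :
    HasRate (fun n => v n * u n) (r + q) := by
  refine ⟨add_nonneg hv.nonneg hu.nonneg, ?_, fun h n => ?_⟩
  · obtain ⟨c, hc⟩ := hv.bound
    obtain ⟨d, hd⟩ := hu.bound
    refine ⟨c * d, fun n => ?_⟩
    have h := mul_le_mul (hc n) (hd n) (by positivity) ((by positivity : (0 : ℝ) ≤ v n).trans (hc n))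
    rw [mul_add, Real.rpow_add (by norm_num)]
    push_cast
    linarith
  · have h1 := hv.trivial (by linarith [hv.nonneg, hu.nonneg]) n
    have h2 := hu.trivial (by linarith [hv.nonneg, hu.nonneg]) n
    simpa using Nat.mul_le_mul h1 h2

theorem HasRate.prod {ι : Type*} (s : Finset ι) {v : ι → ℕ → ℕ} {r : ι → ℝ}
    (h : ∀ i ∈ s, HasRate (v i) (r i)) : HasRate (fun n => ∏ i ∈ s, v i n) (∑ i ∈ s, r i) := by
  classical
  induction s using Finset.induction_on with
  | empty => simpa using HasRate.one
  | insert i s hi ih =>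
    simp only [Finset.prod_insert hi, Finset.sum_insert hi]
    exact (h i (Finset.mem_insert_self i s)).mul
      (ih fun j hj => h j (Finset.mem_insert_of_mem hj))

theorem HasRate.pow {v : ℕ → ℕ} {r : ℝ} (h : HasRate v r) (m : ℕ) :
    HasRate (fun n => v n ^ m) (m * r) := by
  have := HasRate.prod (Finset.range m) (v := fun _ => v) (r := fun _ => r) fun _ _ => h
  simpa using this

theorem HasRate.mono {v u : ℕ → ℕ} {r : ℝ} (h : HasRate v r) (hu : ∀ n, u n ≤ v n) :
    HasRate u r :=
  ⟨h.nonneg, h.bound.imp fun _ hc n => (Nat.cast_le.mpr (hu n)).trans (hc n),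
    fun hr n => (hu n).trans (h.trivial hr n)⟩

theorem one_le_two_rpow {n : ℕ} {r : ℝ} (hr : 0 ≤ r) : (1 : ℝ) ≤ (2 : ℝ) ^ ((n : ℝ) * r) :=
  Real.one_le_rpow (by norm_num) (by positivity)

theorem natCeil_le_two_mul {x : ℝ} (hx : 1 ≤ x) : (⌈x⌉₊ : ℝ) ≤ 2 * x := by
  linarith [Nat.ceil_lt_add_one (zero_le_one.trans hx)]

theorem half_le_natFloor {x : ℝ} (hx : 1 ≤ x) : x / 2 ≤ (⌊x⌋₊ : ℝ) := by
  have h1 : (1 : ℝ) ≤ (⌊x⌋₊ : ℝ) := by exact_mod_cast Nat.le_floor (by simpa using hx)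
  linarith [Nat.lt_floor_add_one x]

theorem hasRate_ceil {r : ℝ} (hr : 0 ≤ r) :
    HasRate (fun n => ⌈(2 : ℝ) ^ ((n : ℝ) * r)⌉₊) r :=
  ⟨hr, ⟨2, fun _ => natCeil_le_two_mul (one_le_two_rpow hr)⟩, fun h n => by simp [h]⟩

theorem hasRate_floor {r : ℝ} (hr : 0 ≤ r) :
    HasRate (fun n => ⌊(2 : ℝ) ^ ((n : ℝ) * r)⌋₊) r :=
  (hasRate_ceil hr).mono fun _ => Nat.floor_le_ceil _

/-- The error exponent of random coding over an erasure channel is positive below capacity. -/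
theorem HasRate.exists_tendsto {v : ℕ → ℕ} {r : ℝ} (hv : HasRate v r) {b d : ℝ} {F : ℕ}
    (hd0 : 0 ≤ d) (hd1 : d ≤ 1) (hr : r = 0 ∨ r < b * (F * (1 - d))) {cnt : ℕ → ℕ}
    (hcnt : ∀ n, b * n - 1 ≤ cnt n) :
    ∃ s : ℝ, 0 < s ∧ s ≤ 1 ∧ Tendsto (fun n => ((v n - 1 : ℕ) : ℝ) ^ s *
      (d + (1 - d) * (2 : ℝ) ^ (-((F : ℝ) * s))) ^ cnt n) atTop (nhds 0) := by
  rcases hr with hr | hr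
  -- There is no wrong candidate, so the error term is zero whatever the capacity of the phase.
  · refine ⟨1, one_pos, le_rfl, ?_⟩
    have h : ∀ n, v n - 1 = 0 := fun n => Nat.sub_eq_zero_of_le (hv.trivial hr n)
    simp [h]
  have hr0 := hv.nonneg
  obtain ⟨c, hc⟩ := hv.bound
  have hc0 : 0 ≤ c := by
    have := (by positivity : (0 : ℝ) ≤ v 0).trans (hc 0)
    simpa using this
  set L := Real.log 2 with hL
  have hL0 : 0 < L := Real.log_pos (by norm_num)
  have hL1 : L < 1 := by linarith [Real.log_two_lt_d9]
  -- The final exponent is `s L (b F (1 - d) - r (1 + F s L)) / (1 + F s L)`; this inequality makes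
  -- it positive and holds for small `s`.
  obtain ⟨s, hs0, hs1, hs2⟩ : ∃ s : ℝ, 0 < s ∧ s ≤ 1 ∧
      r * (1 + F * s * L) < b * (F * (1 - d)) := by
    refine ⟨min 1 ((b * (F * (1 - d)) - r) / (r * F + 1)), lt_min one_pos
      (div_pos (by linarith) (by positivity)), min_le_left _ _, ?_⟩
    set s := min 1 ((b * (F * (1 - d)) - r) / (r * F + 1)) with hs
    have hs0 : 0 < s := lt_min one_pos (div_pos (by linarith) (by positivity))
    have h1 : s * (r * F + 1) ≤ b * (F * (1 - d)) - r :=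
      (le_div_iff₀ (by positivity)).mp (min_le_right _ _)
    have h2 : r * F * s * L ≤ r * F * s := mul_le_of_le_one_right (by positivity) hL1.le
    nlinarith
  refine ⟨s, hs0, hs1, ?_⟩
  set x := F * s * L with hx
  have hx0 : 0 ≤ x := by positivity
  set y := (1 - d) * (x / (1 + x)) with hy
  have hy0 : 0 ≤ y := mul_nonneg (by linarith) (by positivity)
  have h2x : (2 : ℝ) ^ (-((F : ℝ) * s)) = Real.exp (-x) := by
    rw [Real.rpow_def_of_pos (by norm_num), ← hL, hx]
    congr 1
    ring
  -- Combines `exp (-x) ≤ 1 / (1 + x)` with `1 - y ≤ exp (-y)`.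
  have hrho : d + (1 - d) * (2 : ℝ) ^ (-((F : ℝ) * s)) ≤ Real.exp (-y) := by
    have h1 : Real.exp (-x) ≤ 1 - x / (1 + x) := by
      rw [Real.exp_neg, inv_le_comm₀ (Real.exp_pos _) (by
        rw [sub_pos, div_lt_one (by positivity)]; linarith)]
      have : (1 - x / (1 + x))⁻¹ = x + 1 := by
        field_simp
        ring
      rw [this]
      exact Real.add_one_le_exp x
    have h2 := Real.add_one_le_exp (-y)
    have h3 := mul_le_mul_of_nonneg_left h1 (by linarith : 0 ≤ 1 - d)
    rw [h2x]
    nlinarith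
  have hrho0 : 0 ≤ d + (1 - d) * (2 : ℝ) ^ (-((F : ℝ) * s)) :=
    add_nonneg hd0 (mul_nonneg (by linarith) (by positivity))
  set h := y * b - r * s * L with hh
  have hpos : 0 < h := by
    have : h = s * L * ((b * (F * (1 - d)) - r * (1 + x)) / (1 + x)) := by
      rw [hh, hy, hx]
      field_simp
    rw [this]
    exact mul_pos (by positivity) (div_pos (by linarith) (by positivity))
  -- The factor `exp y` pays for the `- 1` in `hcnt`.
  have hlim : Tendsto (fun n : ℕ => c ^ s * Real.exp y * Real.exp (-(h * n))) atTop (nhds 0) := by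
    rw [← mul_zero (c ^ s * Real.exp y)]
    refine Tendsto.const_mul _ (Real.tendsto_exp_neg_atTop_nhds_zero.comp ?_)
    exact tendsto_natCast_atTop_atTop.const_mul_atTop hpos
  refine squeeze_zero (fun n => by positivity) (fun n => ?_) hlim
  have h1 : ((v n - 1 : ℕ) : ℝ) ^ s ≤ c ^ s * Real.exp (r * s * L * n) := by
    have h3 : ((v n - 1 : ℕ) : ℝ) ≤ c * (2 : ℝ) ^ ((n : ℝ) * r) :=
      (Nat.cast_le.mpr (Nat.sub_le _ _)).trans (hc n)
    refine (Real.rpow_le_rpow (by positivity) h3 hs0.le).trans (le_of_eq ?_)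
    rw [Real.mul_rpow hc0 (by positivity), ← Real.rpow_mul (by norm_num),
      Real.rpow_def_of_pos (by norm_num : (0 : ℝ) < 2), ← hL]
    ring_nf
  have h2 : (d + (1 - d) * (2 : ℝ) ^ (-((F : ℝ) * s))) ^ cnt n ≤
      Real.exp y * Real.exp (-(y * b * n)) := by
    refine (pow_le_pow_left₀ hrho0 hrho _).trans ?_
    rw [← Real.exp_nat_mul, ← Real.exp_add]
    refine Real.exp_le_exp.mpr ?_
    nlinarith [hcnt n]
  calc _ ≤ (c ^ s * Real.exp (r * s * L * n)) * (Real.exp y * Real.exp (-(y * b * n))) :=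
        mul_le_mul h1 h2 (by positivity) (by positivity)
    _ = c ^ s * Real.exp y * (Real.exp (r * s * L * n) * Real.exp (-(y * b * n))) := by ring
    _ = _ := by
        rw [← Real.exp_add, hh]
        ring_nf

/-- The time can be shared among phases of lengths proportional to `b`. -/
theorem exists_phases {κ : Type*} [Fintype κ] [DecidableEq κ] [Nonempty κ] {b : κ → ℝ}
    (hb : ∀ k, 0 ≤ b k) (hsum : ∑ k, b k = 1) (n : ℕ) :
    ∃ ph : Fin n → κ, ∀ k, b k * n - 1 ≤ (Finset.univ.filter (fun i => ph i = k)).card := by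
  classical
  have hcard : Fintype.card (Σ k, Fin ⌊b k * n⌋₊) ≤ Fintype.card (Fin n) := by
    simp only [Fintype.card_sigma, Fintype.card_fin]
    have h : ((∑ k, ⌊b k * n⌋₊ : ℕ) : ℝ) ≤ n := by
      push_cast
      calc _ ≤ ∑ k, b k * n := Finset.sum_le_sum fun k _ =>
            Nat.floor_le (mul_nonneg (hb k) (by positivity))
        _ = n := by rw [← Finset.sum_mul, hsum, one_mul]
    exact_mod_cast h
  obtain ⟨e⟩ := Function.Embedding.nonempty_of_card_le hcard
  -- Times left over by rounding go to an arbitrary phase.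
  refine ⟨Function.extend e Sigma.fst fun _ => Classical.arbitrary κ, fun k => ?_⟩
  have h1 : ⌊b k * n⌋₊ ≤ (Finset.univ.filter (fun i =>
      Function.extend e Sigma.fst (fun _ => Classical.arbitrary κ) i = k)).card := by
    rw [← Fintype.card_fin ⌊b k * n⌋₊, ← Finset.card_univ]
    refine Finset.card_le_card_of_injOn (fun i => e ⟨k, i⟩) (fun i _ => ?_) ?_
    · simp [e.injective.extend_apply]
    · intro i _ j _ hij
      simpa using e.injective hij
  have h2 := Nat.lt_floor_add_one (b k * n)
  have h3 : ((⌊b k * n⌋₊ : ℕ) : ℝ) ≤ _ := Nat.cast_le.mpr h1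
  linarith

/-- A message of rate below `m a + b` splits into `m` parts of rate `a` and one of rate `b`. -/
theorem eventually_ceil_le_floor_pow_mul {r a b : ℝ} (m : ℕ) (hr : 0 ≤ r) (ha : 0 ≤ a)
    (hb : 0 ≤ b) (h : r < m * a + b) :
    ∀ᶠ n : ℕ in atTop, ⌈(2 : ℝ) ^ ((n : ℝ) * r)⌉₊ ≤
      ⌊(2 : ℝ) ^ ((n : ℝ) * a)⌋₊ ^ m * ⌊(2 : ℝ) ^ ((n : ℝ) * b)⌋₊ := by
  have hlim : Tendsto (fun n : ℕ => (m * a + b - r) * (n : ℝ)) atTop atTop :=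
    tendsto_natCast_atTop_atTop.const_mul_atTop (by linarith)
  -- Each of the `m + 1` floors and the ceiling costs at most a factor 2, hence `m + 2` bits, which
  -- the linear gap eventually exceeds.
  filter_upwards [hlim.eventually_ge_atTop ((m : ℝ) + 2)] with n hn
  have h1 : (2 : ℝ) ^ (m + 2) * (2 : ℝ) ^ ((n : ℝ) * r) ≤ (2 : ℝ) ^ ((n : ℝ) * (m * a + b)) := by
    rw [← Real.rpow_natCast, ← Real.rpow_add (by norm_num)]
    refine Real.rpow_le_rpow_of_exponent_le (by norm_num) ?_
    push_cast
    linarith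
  have h2 : (2 : ℝ) ^ ((n : ℝ) * (m * a + b)) =
      ((2 : ℝ) ^ ((n : ℝ) * a)) ^ m * (2 : ℝ) ^ ((n : ℝ) * b) := by
    rw [← Real.rpow_natCast, ← Real.rpow_mul (by norm_num), ← Real.rpow_add (by norm_num)]
    ring_nf
  have h3 : ((2 : ℝ) ^ ((n : ℝ) * a) / 2) ^ m * ((2 : ℝ) ^ ((n : ℝ) * b) / 2) ≤
      (⌊(2 : ℝ) ^ ((n : ℝ) * a)⌋₊ : ℝ) ^ m * (⌊(2 : ℝ) ^ ((n : ℝ) * b)⌋₊ : ℝ) := by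
    gcongr
    · exact half_le_natFloor (one_le_two_rpow ha)
    · exact half_le_natFloor (one_le_two_rpow hb)
  have h4 := natCeil_le_two_mul (one_le_two_rpow (n := n) hr)
  have h5 : ((2 : ℝ) ^ ((n : ℝ) * a) / 2) ^ m * ((2 : ℝ) ^ ((n : ℝ) * b) / 2) =
      (2 : ℝ) ^ ((n : ℝ) * (m * a + b)) / 2 ^ (m + 1) := by
    rw [h2, div_pow, pow_succ]
    field_simp
  have h6 : 2 * (2 : ℝ) ^ ((n : ℝ) * r) ≤ (2 : ℝ) ^ ((n : ℝ) * (m * a + b)) / 2 ^ (m + 1) := by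
    rw [le_div_iff₀ (by positivity)]
    refine le_trans (le_of_eq ?_) h1
    rw [pow_succ, pow_succ, pow_succ]
    ring
  have h7 : (⌈(2 : ℝ) ^ ((n : ℝ) * r)⌉₊ : ℝ) ≤
      (⌊(2 : ℝ) ^ ((n : ℝ) * a)⌋₊ : ℝ) ^ m * (⌊(2 : ℝ) ^ ((n : ℝ) * b)⌋₊ : ℝ) := by
    linarith
  exact_mod_cast h7

/-- Rounding the whole down and the parts up lets a sub-message be split into parts at every
blocklength. -/
theorem floor_le_prod_ceil {ι : Type*} (T : Finset ι) (P : ι → ℝ) (a : ℝ) (n : ℕ) :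
    ⌊(2 : ℝ) ^ ((n : ℝ) * a)⌋₊ ≤ (∏ k ∈ T, ⌈(2 : ℝ) ^ ((n : ℝ) * P k)⌉₊) *
      ⌈(2 : ℝ) ^ ((n : ℝ) * (a - ∑ k ∈ T, P k))⌉₊ := by
  have h : (⌊(2 : ℝ) ^ ((n : ℝ) * a)⌋₊ : ℝ) ≤ (∏ k ∈ T, (⌈(2 : ℝ) ^ ((n : ℝ) * P k)⌉₊ : ℝ)) *
      (⌈(2 : ℝ) ^ ((n : ℝ) * (a - ∑ k ∈ T, P k))⌉₊ : ℝ) := by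
    calc _ ≤ (2 : ℝ) ^ ((n : ℝ) * a) := Nat.floor_le (by positivity)
      _ = (∏ k ∈ T, (2 : ℝ) ^ ((n : ℝ) * P k)) *
          (2 : ℝ) ^ ((n : ℝ) * (a - ∑ k ∈ T, P k)) := by
        rw [← Real.rpow_sum_of_pos (by norm_num), ← Real.rpow_add (by norm_num),
          ← Finset.mul_sum]
        ring_nf
      _ ≤ _ := by
        gcongr with k _
        · exact Nat.le_ceil _
        · exact Nat.le_ceil _
  exact_mod_cast h

/-! ### Combinatorics of the coded packets. -/

theorem mem_cacheSets {K K₀ t : ℕ} {T : Finset (Fin K)} :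
    T ∈ cacheSets K K₀ t ↔ (∀ i ∈ T, (i : ℕ) < K₀) ∧ T.card = t := by
  simp [cacheSets, Finset.mem_powersetCard, Finset.subset_iff]

/-- The index sets of the coded packets of phase `k`: the `t`-subsets of the cached receivers
that come after `k`. -/
def codedSets (K₀ t : ℕ) {K : ℕ} (k : Fin K) : Finset (Finset (Fin K)) :=
  (Finset.univ.filter (fun i : Fin K => k < i ∧ (i : ℕ) < K₀)).powersetCard t

theorem mem_codedSets {K K₀ t : ℕ} {k : Fin K} {T : Finset (Fin K)} :
    T ∈ codedSets K₀ t k ↔ (∀ i ∈ T, k < i ∧ (i : ℕ) < K₀) ∧ T.card = t := by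
  simp [codedSets, Finset.mem_powersetCard, Finset.subset_iff]

theorem card_codedSets {K K₀ : ℕ} (t : ℕ) (hK₀ : K₀ ≤ K) (k : Fin K) :
    (codedSets K₀ t k).card = (K₀ - ((k : ℕ) + 1)).choose t := by
  rw [codedSets, Finset.card_powersetCard]
  congr 1
  rw [← Nat.card_Ico]
  refine Finset.card_bij (fun i _ => (i : ℕ)) ?_ (fun i _ j _ h => Fin.ext h) ?_
  · intro i hi
    simp only [Finset.mem_filter, Finset.mem_univ, true_and, Fin.lt_def] at hi
    simp only [Finset.mem_Ico]
    omega
  · intro i hi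
    simp only [Finset.mem_Ico] at hi
    exact ⟨⟨i, by omega⟩, Finset.mem_filter.mpr
      ⟨Finset.mem_univ _, Fin.lt_def.mpr (by change (k : ℕ) < i; omega), by change i < K₀; omega⟩, rfl⟩

theorem card_cacheSets {K K₀ : ℕ} (t : ℕ) (hK₀ : K₀ ≤ K) :
    (cacheSets K K₀ t).card = K₀.choose t := by
  rw [cacheSets, Finset.card_powersetCard]
  congr 1
  rw [Fin.card_filter_val_lt, min_eq_right hK₀]

theorem card_cacheSets_mem_le {K K₀ t : ℕ} (hK₀ : K₀ ≤ K) {k : Fin K}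
    (hk : (k : ℕ) < K₀) :
    ((cacheSets K K₀ t).filter (fun T => k ∈ T)).card ≤ (K₀ - 1).choose (t - 1) := by
  have h : (((Finset.univ.filter (fun i : Fin K => (i : ℕ) < K₀)).erase k).powersetCard
      (t - 1)).card = (K₀ - 1).choose (t - 1) := by
    rw [Finset.card_powersetCard, Finset.card_erase_of_mem (by simpa using hk),
      Fin.card_filter_val_lt, min_eq_right hK₀]
  rw [← h]
  refine Finset.card_le_card_of_injOn (fun T => T.erase k) (fun T hT => ?_) ?_
  · rw [Finset.mem_coe, Finset.mem_filter, mem_cacheSets] at hT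
    rw [Finset.mem_coe, Finset.mem_powersetCard]
    refine ⟨fun i hi => ?_, by rw [Finset.card_erase_of_mem hT.2, hT.1.2]⟩
    rw [Finset.mem_erase] at hi
    simpa [hi.1] using hT.1.1 i hi.2
  · intro T hT T' hT' h
    rw [Finset.mem_coe, Finset.mem_filter] at hT hT'
    rw [← Finset.insert_erase hT.2, ← Finset.insert_erase hT'.2]
    exact congrArg (insert k) h

/-- The coded packet of phase `k` that serves receiver `k` and the receivers in `T`, where `σ j T`
is the sub-message of receiver `j` with index set `T`. -/
def codedPacket {K : ℕ} {S : Type} [AddCommGroup S] (σ : Fin K → Finset (Fin K) → S) (k : Fin K)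
    (T : Finset (Fin K)) : S :=
  σ k T + ∑ j ∈ T, σ j (insert k (T.erase j))

/-- The cache contents and the coded packets of the first `j` phases determine the sub-messages
of receiver `j`. -/
theorem subMessage_eq_of_codedPacket_eq {K K₀ t : ℕ} {S : Type} [AddCommGroup S]
    {σ σ' : Fin K → Finset (Fin K) → S} {j : Fin K} (hj : (j : ℕ) < K₀)
    (hcache : ∀ i, ∀ T ∈ cacheSets K K₀ t, j ∈ T → σ i T = σ' i T)
    (hcoded : ∀ k ≤ j, ∀ T ∈ codedSets K₀ t k, codedPacket σ k T = codedPacket σ' k T)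
    {T : Finset (Fin K)} (hT : T ∈ cacheSets K K₀ t) : σ j T = σ' j T := by
  by_cases hjT : j ∈ T
  · exact hcache j T hT hjT
  have hT' := mem_cacheSets.mp hT
  have hswap : ∀ (k i : Fin K) (A : Finset (Fin K)), (k : ℕ) < K₀ → k ∉ A → i ∈ A →
      (∀ x ∈ A, (x : ℕ) < K₀) → A.card = t → insert k (A.erase i) ∈ cacheSets K K₀ t := by
    intro k i A hk hkA hi hA hc
    rw [mem_cacheSets]
    refine ⟨fun x hx => ?_, ?_⟩
    · rcases Finset.mem_insert.mp hx with rfl | hx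
      · exact hk
      · exact hA x (Finset.mem_of_mem_erase hx)
    · rw [Finset.card_insert_of_notMem (fun h => hkA (Finset.mem_of_mem_erase h)),
        Finset.card_erase_of_mem hi, hc]
      have := Finset.card_pos.mpr ⟨i, hi⟩
      omega
  -- If all of `T` comes after `j`, then `σ j T` is the leading term of packet `T` in phase `j`; all
  -- other terms have `j` in their index set and are cached.
  by_cases hmin : ∀ i ∈ T, j < i
  · have h := hcoded j le_rfl T (mem_codedSets.mpr ⟨fun i hi => ⟨hmin i hi, hT'.1 i hi⟩, hT'.2⟩)
    have h2 : ∑ i ∈ T, σ i (insert j (T.erase i)) = ∑ i ∈ T, σ' i (insert j (T.erase i)) :=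
      Finset.sum_congr rfl fun i hi => hcache i _
        (hswap j i T hj hjT hi hT'.1 hT'.2) (Finset.mem_insert_self _ _)
    rw [codedPacket, codedPacket, h2] at h
    exact add_right_cancel h
  · push Not at hmin
    obtain ⟨i₀, hi₀, hi₀j⟩ := hmin
    have hne : T.Nonempty := ⟨i₀, hi₀⟩
    -- Otherwise phase `k = min T` delivers it: exchanging `k` for `j` gives a set `A` of receivers
    -- after `k`, and in its packet the term of `j` has index set `T`. The other index sets contain
    -- `j`.
    set k := T.min' hne with hk
    have hkT : k ∈ T := T.min'_mem hne
    have hkj : k < j := lt_of_le_of_ne ((T.min'_le i₀ hi₀).trans hi₀j)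
      fun h => hjT (h ▸ hkT)
    set A := insert j (T.erase k) with hA
    have hjA : j ∈ A := Finset.mem_insert_self _ _
    have hjTk : j ∉ T.erase k := fun h => hjT (Finset.mem_of_mem_erase h)
    have hkA : k ∉ A := by
      simp [hA, hkj.ne]
    have hAc : A ∈ cacheSets K K₀ t := hswap j k T hj hjT hkT hT'.1 hT'.2
    have hA' := mem_cacheSets.mp hAc
    have hAk : A ∈ codedSets K₀ t k := by
      refine mem_codedSets.mpr ⟨fun i hi => ⟨?_, hA'.1 i hi⟩, hA'.2⟩
      rcases Finset.mem_insert.mp hi with rfl | hi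
      · exact hkj
      · exact T.min'_lt_of_mem_erase_min' hne hi
    have hAj : insert k (A.erase j) = T := by
      rw [hA, Finset.erase_insert hjTk, Finset.insert_erase hkT]
    have h := hcoded k hkj.le A hAk
    rw [codedPacket, codedPacket, hcache k A hAc hjA, add_right_inj,
      ← Finset.add_sum_erase _ _ hjA, ← Finset.add_sum_erase _ _ hjA, hAj] at h
    have h2 : ∑ i ∈ A.erase j, σ i (insert k (A.erase i)) =
        ∑ i ∈ A.erase j, σ' i (insert k (A.erase i)) := by
      refine Finset.sum_congr rfl fun i hi => hcache i _
        (hswap k i A (lt_trans hkj hj) hkA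
          (Finset.mem_of_mem_erase hi) hA'.1 hA'.2) ?_
      exact Finset.mem_insert_of_mem (Finset.mem_erase.mpr ⟨(Finset.ne_of_mem_erase hi).symm, hjA⟩)
    rw [h2] at h
    exact add_right_cancel h

/-! ### Joint cache-channel codes. -/

/-- The indices of the sub-messages cached at receiver `j`. -/
abbrev CacheIndex (D K₀ t : ℕ) {K : ℕ} (j : Fin K) : Type :=
  {p : Fin D × Finset (Fin K) // p.2 ∈ cacheSets K K₀ t ∧ j ∈ p.2}

/-- The phases that receiver `j` decodes. -/
def decodedPhases (K₀ : ℕ) {K : ℕ} (j : Fin K) : Finset (Fin K) :=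
  if (j : ℕ) < K₀ then Finset.univ.filter (fun k => k ≤ j)
  else Finset.univ.filter (fun k => (k : ℕ) < K₀ ∨ k = j)

/-- The number of messages of phase `k` among which receiver `j` decides. Receiver `k` knows the
piggybacked parts of its own phase. -/
def phaseCount (K₀ t : ℕ) {K : ℕ} (A B : ℕ) (q : Finset (Fin K) → Fin K → Fin K → ℕ)
    (j k : Fin K) : ℕ :=
  B * A ^ (codedSets K₀ t k).card *
    if j = k ∧ (k : ℕ) < K₀ then 1 else ∏ T : Finset (Fin K), ∏ l, q T k l

open Classical in
/-- Joint cache-channel coding for one demand vector `d`. The sub-message `T` of the message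
demanded by receiver `l` is split into parts for the different phases, the part for phase `k`
having `q T k l` values. -/
theorem IsErasureBC.exists_piggyback_code {K D F n K₀ t : ℕ} {δ : Fin K → ℝ}
    {Q : Packet F → (Fin K → Output F) → ℝ} (hQ : IsErasureBC δ Q)
    (hδ0 : ∀ k, 0 ≤ δ k) (hδ1 : ∀ k, δ k ≤ 1)
    {V S U : Type} [Fintype V] [Nonempty V] [Fintype S] [AddCommGroup S] [Fintype U]
    (sub : V → Finset (Fin K) → S) (unc : V → U)
    (hinj : ∀ v v', (∀ T ∈ cacheSets K K₀ t, sub v T = sub v' T) → unc v = unc v' → v = v')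
    (q : Finset (Fin K) → Fin K → Fin K → ℕ)
    (hq : ∀ T ∈ cacheSets K K₀ t, ∀ l : Fin K, K₀ ≤ (l : ℕ) → Fintype.card S ≤ ∏ k, q T k l)
    (hq_pos : ∀ T k l, 0 < q T k l)
    (hq_weak : ∀ T (k l : Fin K), (k : ℕ) < K₀ → ¬ (T ∈ cacheSets K K₀ t ∧ k ∈ T) → q T k l = 1)
    (hq_strong : ∀ T (k l : Fin K), K₀ ≤ (k : ℕ) → k ≠ l → q T k l = 1)
    (d : Fin K → Fin D) (ph : Fin n → Fin K)
    (s : Fin K → Fin K → ℝ) (hs : ∀ j k, 0 < s j k) (hs1 : ∀ j k, s j k ≤ 1) :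
    ∃ (enc : (Fin D → V) → Fin n → Packet F)
      (dec : ∀ j, (Fin n → Output F) → (CacheIndex D K₀ t j → S) → V),
      ∑ w : Fin D → V, ∑ y : Fin n → Fin K → Output F,
        (if ∃ j, dec j (fun i => y i j) (fun p => sub (w p.1.1) p.1.2) ≠ w (d j)
          then ∏ i, Q (enc w i) (y i) else 0) ≤
      Fintype.card (Fin D → V) * ∑ j, ∑ k ∈ decodedPhases K₀ j,
        ((phaseCount K₀ t (Fintype.card S) (Fintype.card U) q j k - 1 : ℕ) : ℝ) ^ s j k *
        (δ j + (1 - δ j) * (2 : ℝ) ^ (-((F : ℝ) * s j k))) ^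
          (Finset.univ.filter (fun i => ph i = k)).card := by
  have hpart : ∀ T l, ∃ f : S → ∀ k, Fin (q T k l),
      T ∈ cacheSets K K₀ t → K₀ ≤ (l : ℕ) → Function.Injective f := by
    intro T l
    by_cases h : T ∈ cacheSets K K₀ t ∧ K₀ ≤ (l : ℕ)
    · obtain ⟨e⟩ := Function.Embedding.nonempty_of_card_le
        (α := S) (β := ∀ k, Fin (q T k l)) (by simpa using hq T h.1 l h.2)
      exact ⟨e, fun _ _ => e.injective⟩
    · exact ⟨fun _ k => ⟨0, hq_pos T k l⟩, fun h1 h2 => absurd ⟨h1, h2⟩ h⟩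
  choose part hpart using hpart
  -- The components are the uncached rest, the coded packets and the parts of sub-messages. For
  -- strong `k`, `hq_strong` makes all parts trivial except those of the message of `k` itself.
  let m : Fin K → (Fin D → V) → U × (Finset (Fin K) → S) × (Finset (Fin K) → Fin K → ℕ) :=
    fun k w => (unc (w (d k)),
      fun T => if T ∈ codedSets K₀ t k then codedPacket (fun j => sub (w (d j))) k T else 0,
      fun T l => part T l (sub (w (d l)) T) k)
  refine hQ.exists_phase_code hδ0 hδ1 ph m (S := fun j => CacheIndex D K₀ t j → S)
    (fun j w p => sub (w p.1.1) p.1.2)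
    (fun j w => w (d j)) (decodedPhases K₀) ?_
    (phaseCount K₀ t (Fintype.card S) (Fintype.card U) q) ?_ s hs hs1
  · intro j w w' hside hm
    have hcache : ∀ e, ∀ T ∈ cacheSets K K₀ t, j ∈ T → sub (w e) T = sub (w' e) T :=
      fun e T hT hj => congrFun hside ⟨(e, T), hT, hj⟩
    have hjj : j ∈ decodedPhases K₀ j := by
      unfold decodedPhases
      split_ifs <;> simp
    refine hinj _ _ ?_ (congrArg Prod.fst (hm j hjj))
    by_cases hj : (j : ℕ) < K₀
    · refine fun T hT => subMessage_eq_of_codedPacket_eq (σ := fun j => sub (w (d j)))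
        (σ' := fun j => sub (w' (d j))) hj (fun i => hcache (d i)) (fun k hk A hA => ?_) hT
      have h := congrFun (congrArg (fun x => x.2.1) (hm k (by simpa [decodedPhases, hj] using hk))) A
      simpa [m, hA] using h
    · refine fun T hT => hpart T j hT (not_lt.mp hj) ?_
      ext k
      by_cases hk : (k : ℕ) < K₀ ∨ k = j
      · have h := congrFun (congrFun
          (congrArg (fun x => x.2.2) (hm k (by simpa [decodedPhases, hj] using hk))) T) j
        simpa [m] using h
      -- A phase that `j` does not decode carries only a one-valued part of its message.
      · push Not at hk
        have h1 := hq_strong T k j hk.1 hk.2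
        have h2 := (part T j (sub (w (d j)) T) k).isLt
        have h3 := (part T j (sub (w' (d j)) T) k).isLt
        omega
  · intro j k _ w I hI
    have hC : (Fintype.piFinset fun T : Finset (Fin K) =>
        if T ∈ codedSets K₀ t k then (Finset.univ : Finset S) else {0}).card =
        Fintype.card S ^ (codedSets K₀ t k).card := by
      rw [Fintype.card_piFinset, ← Finset.prod_const, ← Finset.prod_filter_mul_prod_filter_not
        Finset.univ (fun T => T ∈ codedSets K₀ t k)]
      rw [Finset.filter_mem_eq_inter, Finset.univ_inter]
      rw [Finset.prod_congr rfl (fun T hT => by rw [if_pos hT]), Finset.prod_eq_one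
        (s := Finset.univ.filter _) (fun T hT => by
          rw [if_neg (Finset.mem_filter.mp hT).2, Finset.card_singleton]), mul_one]
      rfl
    have hsub : ∀ (L : Finset (U × (Finset (Fin K) → S) × (Finset (Fin K) → Fin K → ℕ)))
        (E : Finset (Finset (Fin K) → Fin K → ℕ)),
        (∀ x ∈ L, (∃ w', m k w' = x) ∧ x.2.2 ∈ E) →
        L.card ≤ Fintype.card U * Fintype.card S ^ (codedSets K₀ t k).card * E.card := by
      intro L E hL
      rw [← hC, ← Finset.card_univ, mul_assoc, ← Finset.card_product, ← Finset.card_product]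
      refine Finset.card_le_card fun x hx => ?_
      obtain ⟨⟨w', rfl⟩, hE⟩ := hL x hx
      rw [Finset.mem_product, Finset.mem_product]
      refine ⟨Finset.mem_univ _, ?_, hE⟩
      rw [Fintype.mem_piFinset]
      intro T
      by_cases hT : T ∈ codedSets K₀ t k <;> simp [m, hT]
    unfold phaseCount
    split_ifs with hjk
    · obtain ⟨rfl, hj⟩ := hjk
      -- The cache of `j` fixes the parts with `j ∈ T`, and `hq_weak` makes the others one-valued,
      -- so a single value of this component remains.
      rw [← Finset.card_singleton (m j w).2.2]
      refine hsub _ _ fun x hx => ?_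
      obtain ⟨w', hw, rfl⟩ := hI x hx
      refine ⟨⟨w', rfl⟩, Finset.mem_singleton.mpr ?_⟩
      ext T l
      by_cases hT : T ∈ cacheSets K K₀ t ∧ j ∈ T
      · have h : sub (w' (d l)) T = sub (w (d l)) T := congrFun hw ⟨(d l, T), hT⟩
        simp only [m, h]
      · have h1 := hq_weak T j l hj hT
        have h2 := (part T l (sub (w (d l)) T) j).isLt
        have h3 := (part T l (sub (w' (d l)) T) j).isLt
        simp only [m]
        omega
    · have hE : (Fintype.piFinset fun T => Fintype.piFinset fun l =>
          Finset.range (q T k l)).card = ∏ T, ∏ l, q T k l := by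
        simp [Fintype.card_piFinset]
      rw [← hE]
      refine hsub _ _ fun x hx => ?_
      obtain ⟨w', -, rfl⟩ := hI x hx
      exact ⟨⟨w', rfl⟩, by simp [m]⟩

open Classical in
/-- Codes for the individual demands that use the same cache contents form a caching code. -/
theorem IsErasureBC.exists_cachingCode {K D F n : ℕ} {δ : Fin K → ℝ}
    {Q : Packet F → (Fin K → Output F) → ℝ} (hQ : IsErasureBC δ Q)
    {𝒟 : Finset (Fin K → Fin D)} {R : Fin D → ℝ} {M : Fin K → ℝ} {S : Fin K → Type}
    [∀ j, Fintype (S j)] (hS : ∀ j, (Fintype.card (S j) : ℝ) ≤ (2 : ℝ) ^ ((n : ℝ) * M j))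
    (side : ∀ j, Library n R → S j) {E : ℝ}
    (h : ∀ d : 𝒟, ∃ (enc : Library n R → Fin n → Packet F)
      (dec : ∀ j, (Fin n → Output F) → S j → Message n (R (d.1 j))),
      ∑ w, ∑ y : Fin n → Fin K → Output F,
        (if ∃ j, dec j (fun i => y i j) (side j w) ≠ w (d.1 j)
          then ∏ i, Q (enc w i) (y i) else 0) ≤ Fintype.card (Library n R) * E) :
    ∃ c : CachingCode F n 𝒟 R M, c.errorProb Q ≤ 𝒟.card * E := by
  choose enc dec herr using h
  refine ⟨⟨fun j => Fintype.card (S j), hS, fun j w => Fintype.equivFin _ (side j w), enc,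
    fun j d z σ => dec d j z ((Fintype.equivFin _).symm σ)⟩, ?_⟩
  have hcard : (0 : ℝ) < Fintype.card (Library n R) := by
    have : Nonempty (Library n R) := ⟨fun d => ⟨0, Nat.ceil_pos.mpr (by positivity)⟩⟩
    exact_mod_cast Fintype.card_pos
  rw [CachingCode.errorProb, div_le_iff₀ hcard]
  simp only [Equiv.symm_apply_apply]
  -- For an event about demand `d`, the transmissions for the other demands sum out to 1.
  have hprod : ∀ (w : Library n R) (d : 𝒟) (B : (Fin n → Fin K → Output F) → ℝ),
      ∑ y : 𝒟 → Fin n → Fin K → Output F, B (y d) * ∏ d', ∏ i, Q (enc d' w i) (y d' i) =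
        ∑ y : Fin n → Fin K → Output F, B y * ∏ i, Q (enc d w i) (y i) := by
    intro w d B
    have h1 := Finset.prod_univ_sum
      (fun _ : 𝒟 => (Finset.univ : Finset (Fin n → Fin K → Output F)))
      (fun d' y => (if d' = d then B y else 1) * ∏ i, Q (enc d' w i) (y i))
    rw [Fintype.piFinset_univ] at h1
    have h2 : ∀ y : 𝒟 → Fin n → Fin K → Output F,
        ∏ d', ((if d' = d then B (y d') else 1) * ∏ i, Q (enc d' w i) (y d' i)) =
        B (y d) * ∏ d', ∏ i, Q (enc d' w i) (y d' i) := by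
      intro y
      rw [Finset.prod_mul_distrib, Finset.prod_ite_eq' Finset.univ d (fun d' => B (y d')),
        if_pos (Finset.mem_univ _)]
    simp_rw [h2] at h1
    rw [← h1, ← Finset.mul_prod_erase _ _ (Finset.mem_univ d), Finset.prod_eq_one, mul_one]
    · simp
    · intro d' hd'
      simp only [if_neg (Finset.ne_of_mem_erase hd'), one_mul]
      exact hQ.sum_eq_one' _
  calc _ ≤ ∑ w : Library n R, ∑ y : 𝒟 → Fin n → Fin K → Output F, ∑ d : 𝒟,
        (if ∃ j, dec d j (fun i => y d i j) (side j w) ≠ w (d.1 j) then (1 : ℝ) else 0) *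
          ∏ d', ∏ i, Q (enc d' w i) (y d' i) := by
        refine Finset.sum_le_sum fun w _ => Finset.sum_le_sum fun y _ => ?_
        have hq : 0 ≤ ∏ d', ∏ i, Q (enc d' w i) (y d' i) :=
          Finset.prod_nonneg fun _ _ => Finset.prod_nonneg fun _ _ => hQ.nonneg _ _
        rw [← Finset.sum_mul]
        split_ifs with h
        · obtain ⟨d, hd⟩ := h
          refine le_mul_of_one_le_left hq ?_
          refine le_trans ?_ (Finset.single_le_sum (fun d _ => by positivity)
            (Finset.mem_univ d))
          rw [if_pos hd]
        · positivity
    _ = ∑ d : 𝒟, ∑ w : Library n R, ∑ y : Fin n → Fin K → Output F,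
        (if ∃ j, dec d j (fun i => y i j) (side j w) ≠ w (d.1 j) then (1 : ℝ) else 0) *
          ∏ i, Q (enc d w i) (y i) := by
        rw [Finset.sum_comm]
        simp_rw [Finset.sum_comm (s := (Finset.univ : Finset (𝒟 → Fin n → Fin K → Output F)))]
        rw [Finset.sum_comm]
        refine Finset.sum_congr rfl fun d _ => Finset.sum_congr rfl fun w _ => ?_
        exact hprod w d fun y =>
          if ∃ j, dec d j (fun i => y i j) (side j w) ≠ w (d.1 j) then (1 : ℝ) else 0
    _ ≤ ∑ _d : 𝒟, Fintype.card (Library n R) * E := by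
        refine Finset.sum_le_sum fun d _ => ?_
        refine le_trans (le_of_eq ?_) (herr d)
        refine Finset.sum_congr rfl fun w _ => Finset.sum_congr rfl fun y _ => ?_
        rw [ite_mul, one_mul, zero_mul]
    _ = _ := by
        rw [Finset.sum_const, nsmul_eq_mul, Finset.card_univ, Fintype.card_coe]
        ring

/-! ### Phase rates and cache sizes. -/

theorem subRate_nonneg {D K₀ t : ℕ} {M : ℝ} (hM : 0 ≤ M) : 0 ≤ subRate D K₀ t M :=
  div_nonneg hM (by positivity)

/-- The cache budget: of each of the `D` messages, a weak receiver stores the sub-messages whose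
index set contains it. -/
theorem mul_choose_mul_subRate {D K₀ t : ℕ} (M : ℝ) (hD : 0 < D) (htK₀ : t ≤ K₀) :
    (D : ℝ) * ((K₀ - 1).choose (t - 1) : ℝ) * subRate D K₀ t M = M := by
  have h : (0 : ℝ) < (K₀ - 1).choose (t - 1) := by
    exact_mod_cast Nat.choose_pos (by omega)
  have hD' : (0 : ℝ) < D := by exact_mod_cast hD
  rw [subRate]
  field_simp

/-- Double counting of the pairs `k ∈ T` gives the total cached rate of one message. -/
theorem choose_mul_subRate {D K₀ t : ℕ} (M : ℝ) (hD : 0 < D) (ht : 1 ≤ t) (htK₀ : t ≤ K₀) :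
    (K₀.choose t : ℝ) * subRate D K₀ t M = M * K₀ / (D * t) := by
  have h : (0 : ℝ) < (K₀ - 1).choose (t - 1) := by
    exact_mod_cast Nat.choose_pos (by omega)
  have hD' : (0 : ℝ) < D := by exact_mod_cast hD
  have ht' : (0 : ℝ) < t := by exact_mod_cast ht
  obtain ⟨t, rfl⟩ := Nat.exists_eq_add_of_le' ht
  obtain ⟨k, rfl⟩ := Nat.exists_eq_add_of_le' (ht.trans htK₀)
  have h2 : ((k : ℝ) + 1) * (k.choose t : ℝ) = ((k + 1).choose (t + 1) : ℝ) * ((t : ℝ) + 1) := by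
    exact_mod_cast Nat.add_one_mul_choose_eq k t
  rw [subRate, mul_div_assoc', div_eq_div_iff (by positivity) (by positivity)]
  push_cast [Nat.add_sub_cancel]
  linear_combination (-(M * D)) * h2

open Classical in
/-- The rate of the part for phase `k` of the sub-message `T` of the message demanded by
receiver `l`: the piggybacked rates `P T k l` for `k ∈ T`, and the remainder for `k = l`. -/
noncomputable def partRate {K : ℕ} (K₀ t : ℕ) (a : ℝ) (P : Finset (Fin K) → Fin K → Fin K → ℝ)
    (T : Finset (Fin K)) (k l : Fin K) : ℝ :=
  if T ∈ cacheSets K K₀ t ∧ K₀ ≤ (l : ℕ) then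
    if k ∈ T then P T k l else if k = l then a - ∑ i ∈ T, P T i l else 0
  else 0

theorem partRate_nonneg {K K₀ t : ℕ} {a : ℝ} {P : Finset (Fin K) → Fin K → Fin K → ℝ}
    (hP : ∀ T k l, 0 ≤ P T k l)
    (hPa : ∀ T ∈ cacheSets K K₀ t, ∀ l : Fin K, K₀ ≤ (l : ℕ) → ∑ k ∈ T, P T k l ≤ a)
    (T : Finset (Fin K)) (k l : Fin K) : 0 ≤ partRate K₀ t a P T k l := by
  unfold partRate
  split_ifs with h
  · exact hP T k l
  · exact sub_nonneg.mpr (hPa T h.1 l h.2)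
  · exact le_rfl
  · exact le_rfl

theorem notMem_of_mem_cacheSets {K K₀ t : ℕ} {T : Finset (Fin K)} (hT : T ∈ cacheSets K K₀ t)
    {l : Fin K} (hl : K₀ ≤ (l : ℕ)) : l ∉ T :=
  fun h => absurd ((mem_cacheSets.mp hT).1 l h) (not_lt.mpr hl)

theorem sum_partRate_weak {K K₀ t : ℕ} {a : ℝ} {P : Finset (Fin K) → Fin K → Fin K → ℝ}
    {C : Fin K → Fin K → ℝ}
    (hPC : ∀ k l : Fin K, (k : ℕ) < K₀ → K₀ ≤ (l : ℕ) →
      C k l = ∑ T ∈ (cacheSets K K₀ t).filter (fun T => k ∈ T), P T k l)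
    {k : Fin K} (hk : (k : ℕ) < K₀) :
    ∑ T, ∑ l, partRate K₀ t a P T k l =
      ∑ l ∈ Finset.univ.filter (fun l : Fin K => K₀ ≤ (l : ℕ)), C k l := by
  classical
  rw [Finset.sum_comm, Finset.sum_filter]
  refine Finset.sum_congr rfl fun l _ => ?_
  split_ifs with hl
  · rw [hPC k l hk hl, Finset.sum_filter, ← Finset.sum_filter_add_sum_filter_not Finset.univ
      (fun T => T ∈ cacheSets K K₀ t), Finset.filter_mem_eq_inter, Finset.univ_inter,
      Finset.sum_eq_zero (s := Finset.univ.filter _), add_zero]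
    · refine Finset.sum_congr rfl fun T hT => ?_
      have hkl : k ≠ l := fun h => by rw [h] at hk; omega
      simp [partRate, hT, hl, hkl]
    · intro T hT
      simp [partRate, (Finset.mem_filter.mp hT).2]
  · exact Finset.sum_eq_zero fun T _ => by simp [partRate, hl]

/-- Only remainders `a - ∑ i ∈ T, P T i l` are sent in the phase of a strong receiver; summing `P`
over the pairs `k ∈ T` in the other order gives the `C k l`. -/
theorem sum_partRate_strong {K K₀ t : ℕ} {a : ℝ} {P : Finset (Fin K) → Fin K → Fin K → ℝ}
    {C : Fin K → Fin K → ℝ}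
    (hPC : ∀ k l : Fin K, (k : ℕ) < K₀ → K₀ ≤ (l : ℕ) →
      C k l = ∑ T ∈ (cacheSets K K₀ t).filter (fun T => k ∈ T), P T k l)
    {l : Fin K} (hl : K₀ ≤ (l : ℕ)) :
    ∑ T, ∑ l', partRate K₀ t a P T l l' =
      (cacheSets K K₀ t).card * a -
        ∑ k ∈ Finset.univ.filter (fun k : Fin K => (k : ℕ) < K₀), C k l := by
  classical
  have h1 : ∀ T ∈ cacheSets K K₀ t, ∑ l', partRate K₀ t a P T l l' = a - ∑ i ∈ T, P T i l := by
    intro T hT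
    rw [Finset.sum_eq_single l]
    · simp [partRate, hT, hl, notMem_of_mem_cacheSets hT hl]
    · intro l' _ hne
      simp [partRate, notMem_of_mem_cacheSets hT hl, hne.symm]
    · simp
  have h2 : ∑ k ∈ Finset.univ.filter (fun k : Fin K => (k : ℕ) < K₀), C k l =
      ∑ T ∈ cacheSets K K₀ t, ∑ k ∈ T, P T k l := by
    rw [Finset.sum_congr rfl fun k hk => hPC k l (Finset.mem_filter.mp hk).2 hl]
    refine Finset.sum_comm' fun k T => ?_
    simp only [Finset.mem_filter, Finset.mem_univ, true_and]
    exact ⟨fun h => ⟨h.2.2, h.2.1⟩, fun h => ⟨(mem_cacheSets.mp h.2).1 k h.1, h.2, h.1⟩⟩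
  rw [← Finset.sum_subset (Finset.subset_univ (cacheSets K K₀ t)), Finset.sum_congr rfl h1,
    Finset.sum_sub_distrib, Finset.sum_const, nsmul_eq_mul, h2]
  intro T _ hT
  simp [partRate, hT]

/-- The rate of the messages of phase `k` among which receiver `j` decides. -/
noncomputable def phaseRate {K : ℕ} (K₀ t : ℕ) (a b : ℝ)
    (P : Finset (Fin K) → Fin K → Fin K → ℝ) (j k : Fin K) : ℝ :=
  b + (K₀ - ((k : ℕ) + 1)).choose t * a +
    if j = k ∧ (k : ℕ) < K₀ then 0 else ∑ T : Finset (Fin K), ∑ l, partRate K₀ t a P T k l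

theorem partRate_smul {K K₀ t : ℕ} (c a : ℝ) (P : Finset (Fin K) → Fin K → Fin K → ℝ)
    (T : Finset (Fin K)) (k l : Fin K) :
    partRate K₀ t (c * a) (fun T k l => c * P T k l) T k l = c * partRate K₀ t a P T k l := by
  unfold partRate
  split_ifs <;> simp [Finset.mul_sum, mul_sub]

/-- Homogeneity allows the whole scheme to be scaled while the phase capacities stay fixed. -/
theorem phaseRate_smul {K K₀ t : ℕ} (c a b : ℝ) (P : Finset (Fin K) → Fin K → Fin K → ℝ)
    (j k : Fin K) :
    phaseRate K₀ t (c * a) (c * b) (fun T k l => c * P T k l) j k =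
      c * phaseRate K₀ t a b P j k := by
  unfold phaseRate
  simp_rw [partRate_smul, ← Finset.mul_sum]
  split_ifs <;> ring

/-- The conditions of the scheme say that every receiver can decode the phases it needs. -/
theorem SchemeConditions.phaseRate_le {K D F K₀ t : ℕ} (hD : 0 < D) (hK₀ : K₀ ≤ K)
    {δ : Fin K → ℝ} (hδ : Antitone δ) {R M : ℝ} (ht : 1 ≤ t) (htK₀ : t ≤ K₀)
    {β : Fin K → ℝ} (hβ : ∀ k, 0 ≤ β k) {C : Fin K → Fin K → ℝ}
    {P : Finset (Fin K) → Fin K → Fin K → ℝ}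
    (hPC : ∀ k l : Fin K, (k : ℕ) < K₀ → K₀ ≤ (l : ℕ) →
      C k l = ∑ T ∈ (cacheSets K K₀ t).filter (fun T => k ∈ T), P T k l)
    (hcond : SchemeConditions (· ≤ ·) D F K₀ t δ R M β C) {j k : Fin K}
    (hjk : k ∈ decodedPhases K₀ j) :
    phaseRate K₀ t (subRate D K₀ t M) (R - K₀.choose t * subRate D K₀ t M) P j k ≤
      β k * (F * (1 - δ j)) := by
  have hT := choose_mul_subRate M hD ht htK₀
  unfold phaseRate
  by_cases hk : (k : ℕ) < K₀
  -- The last `t` weak receivers have fewer than `t` weak successors, so their phases contain no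
  -- coded packets.
  · have hzero : K₀ < (k : ℕ) + 1 + t → (K₀ - ((k : ℕ) + 1)).choose t = 0 := fun h =>
      Nat.choose_eq_zero_of_lt (by omega)
    by_cases hj : j = k
    · rw [if_pos ⟨hj, hk⟩, hj]
      by_cases hkt : (k : ℕ) + 1 + t ≤ K₀
      · linarith [hcond.cond1 k hkt]
      · rw [hzero (not_le.mp hkt), Nat.cast_zero]
        linarith [hcond.cond3 k (not_le.mp hkt) hk]
    · rw [if_neg fun h => hj h.1, sum_partRate_weak hPC hk]
      have hkj : (k : ℕ) + 1 ≤ j := by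
        have hne : (j : ℕ) ≠ k := fun h => hj (Fin.ext h)
        by_cases hjK : (j : ℕ) < K₀
        · have : k ≤ j := by simpa [decodedPhases, hjK] using hjk
          have : (k : ℕ) ≤ j := this
          omega
        · omega
      -- Any other receiver decoding phase `k` comes after `k`, and the channel of its successor
      -- `k'` is the worst among these.
      let k' : Fin K := ⟨k + 1, hkj.trans_lt j.isLt⟩
      have hδ' : δ j ≤ δ k' := hδ (show k' ≤ j from hkj)
      have hcap : β k * (F * (1 - δ k')) ≤ β k * (F * (1 - δ j)) :=
        mul_le_mul_of_nonneg_left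
          (mul_le_mul_of_nonneg_left (by linarith) (by positivity)) (hβ k)
      by_cases hkt : (k : ℕ) + 1 + t ≤ K₀
      · linarith [hcond.cond2 k k' hkt rfl]
      · rw [hzero (not_le.mp hkt), Nat.cast_zero]
        linarith [hcond.cond4 k k' (not_le.mp hkt) hk rfl]
  · have hjk' : k = j := by
      by_cases hjK : (j : ℕ) < K₀
      · have : k ≤ j := by simpa [decodedPhases, hjK] using hjk
        have : (k : ℕ) ≤ j := this
        omega
      · simpa [decodedPhases, hjK, hk] using hjk
    subst hjk'
    -- The uncached rest and the remainders add up to `R - ∑ C`.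
    have h0 : (K₀ - ((k : ℕ) + 1)).choose t = 0 := Nat.choose_eq_zero_of_lt (by omega)
    rw [if_neg fun h => hk h.2, sum_partRate_strong hPC (not_lt.mp hk), h0, Nat.cast_zero,
      card_cacheSets t hK₀]
    linarith [hcond.cond5 k (not_lt.mp hk)]

theorem hasRate_phaseCount {K K₀ t : ℕ} (hK₀ : K₀ ≤ K) {a b : ℝ} (ha : 0 ≤ a) (hb : 0 ≤ b)
    {P : Finset (Fin K) → Fin K → Fin K → ℝ} (hP : ∀ T k l, 0 ≤ P T k l)
    (hPa : ∀ T ∈ cacheSets K K₀ t, ∀ l : Fin K, K₀ ≤ (l : ℕ) → ∑ k ∈ T, P T k l ≤ a)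
    (j k : Fin K) :
    HasRate (fun n => phaseCount K₀ t ⌊(2 : ℝ) ^ ((n : ℝ) * a)⌋₊ ⌊(2 : ℝ) ^ ((n : ℝ) * b)⌋₊
      (fun T k l => ⌈(2 : ℝ) ^ ((n : ℝ) * partRate K₀ t a P T k l)⌉₊) j k)
      (phaseRate K₀ t a b P j k) := by
  unfold phaseCount phaseRate
  rw [card_codedSets t hK₀]
  refine ((hasRate_floor hb).mul ((hasRate_floor ha).pow _)).mul ?_
  split_ifs with h
  · exact HasRate.one
  · exact HasRate.prod _ fun T _ => HasRate.prod _ fun l _ =>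
      hasRate_ceil (partRate_nonneg hP hPa T k l)

theorem floor_le_prod_partRate {K K₀ t : ℕ} {a : ℝ} {P : Finset (Fin K) → Fin K → Fin K → ℝ}
    {T : Finset (Fin K)} (hT : T ∈ cacheSets K K₀ t) {l : Fin K} (hl : K₀ ≤ (l : ℕ)) (n : ℕ) :
    ⌊(2 : ℝ) ^ ((n : ℝ) * a)⌋₊ ≤
      ∏ k, ⌈(2 : ℝ) ^ ((n : ℝ) * partRate K₀ t a P T k l)⌉₊ := by
  classical
  have hlT := notMem_of_mem_cacheSets hT hl
  have h1 : ∀ k ∈ T, partRate K₀ t a P T k l = P T k l := fun k hk => by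
    simp [partRate, hT, hl, hk]
  have h2 : partRate K₀ t a P T l l = a - ∑ k ∈ T, partRate K₀ t a P T k l := by
    rw [Finset.sum_congr rfl h1]
    simp [partRate, hT, hl, hlT]
  refine (floor_le_prod_ceil T (fun k => partRate K₀ t a P T k l) a n).trans ?_
  rw [← h2, mul_comm, ← Finset.prod_insert hlT
    (f := fun k => ⌈(2 : ℝ) ^ ((n : ℝ) * partRate K₀ t a P T k l)⌉₊)]
  exact Finset.prod_le_prod_of_subset_of_one_le' (Finset.subset_univ _)
    fun _ _ _ => Nat.ceil_pos.mpr (by positivity)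

theorem card_cacheIndex_le {K D K₀ t : ℕ} (hK₀ : K₀ ≤ K) {j : Fin K} (hj : (j : ℕ) < K₀) :
    Nat.card (CacheIndex D K₀ t j) ≤ D * (K₀ - 1).choose (t - 1) := by
  classical
  rw [Nat.card_eq_fintype_card, Fintype.card_subtype]
  refine le_trans (Finset.card_le_card (t := (Finset.univ : Finset (Fin D)) ×ˢ
    (cacheSets K K₀ t).filter (fun T => j ∈ T)) fun p hp => ?_) ?_
  · simpa using hp
  · rw [Finset.card_product, Finset.card_univ, Fintype.card_fin]
    exact Nat.mul_le_mul_left _ (card_cacheSets_mem_le hK₀ hj)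

theorem isEmpty_cacheIndex {K D K₀ t : ℕ} {j : Fin K} (hj : K₀ ≤ (j : ℕ)) :
    IsEmpty (CacheIndex D K₀ t j) :=
  ⟨fun p => notMem_of_mem_cacheSets p.2.1 hj p.2.2⟩

theorem weakCaches_nonneg {K K₀ : ℕ} {M : ℝ} (hM : 0 ≤ M) (k : Fin K) :
    0 ≤ weakCaches K K₀ M k := by
  unfold weakCaches
  split_ifs
  · exact hM
  · exact le_rfl

/-! ### Achievability and closure. -/

/-- Every rate below the rate `R` of the scheme is achievable: scaling the scheme by a factor
slightly below `1` leaves room for the rounding and puts every phase with a nonzero rate below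
capacity. -/
theorem achievable_of_lt {K D F K₀ t : ℕ} (hD : 0 < D) (hK₀ : K₀ ≤ K)
    (δ : Fin K → ℝ) (hδ_nonneg : ∀ k, 0 ≤ δ k) (hδ_le : ∀ k, δ k ≤ 1) (hδ : Antitone δ)
    (Q : Packet F → (Fin K → Output F) → ℝ) (hQ : IsErasureBC δ Q)
    (𝒟 : Finset (Fin K → Fin D))
    {R M : ℝ} (hM : 0 ≤ M) (ht : 1 ≤ t) (htK₀ : t ≤ K₀)
    (hR : M * K₀ / (D * t) ≤ R)
    {β : Fin K → ℝ} (hβ_nonneg : ∀ k, 0 ≤ β k) (hβ_sum : ∑ k, β k = 1)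
    {C : Fin K → Fin K → ℝ} (hC : IsPiggybackRates K₀ t (subRate D K₀ t M) C)
    (hcond : SchemeConditions (· ≤ ·) D F K₀ t δ R M β C)
    {R' : ℝ} (hR' : 0 ≤ R') (hR'R : R' < R) :
    Achievable Q 𝒟 (fun _ : Fin D => R') (weakCaches K K₀ M) := by
  classical
  obtain ⟨P, hP, hPa, hPC⟩ := hC
  have hRpos : 0 < R := hR'.trans_lt hR'R
  obtain ⟨θ, hθ0, hθ1, hθR⟩ : ∃ θ : ℝ, 0 < θ ∧ θ < 1 ∧ R' < θ * R := by
    refine ⟨(R' + R) / (2 * R), by positivity, ?_, ?_⟩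
    · rw [div_lt_one (by positivity)]
      linarith
    · have : (R' + R) / (2 * R) * R = (R' + R) / 2 := by field_simp
      rw [this]
      linarith
  set a₀ := subRate D K₀ t M with ha₀
  have ha₀0 : 0 ≤ a₀ := subRate_nonneg hM
  have hTa : (K₀.choose t : ℝ) * a₀ ≤ R := (choose_mul_subRate M hD ht htK₀).trans_le hR
  set a := θ * a₀ with ha
  set b := θ * (R - K₀.choose t * a₀) with hb
  let p : Finset (Fin K) → Fin K → Fin K → ℝ := fun T k l => θ * P T k l
  have ha0 : 0 ≤ a := mul_nonneg hθ0.le ha₀0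
  have hb0 : 0 ≤ b := mul_nonneg hθ0.le (sub_nonneg.mpr hTa)
  have hp : ∀ T k l, 0 ≤ p T k l := fun T k l => mul_nonneg hθ0.le (hP T k l)
  have hpa : ∀ T ∈ cacheSets K K₀ t, ∀ l : Fin K, K₀ ≤ (l : ℕ) → ∑ k ∈ T, p T k l ≤ a := by
    intro T hT l hl
    rw [← Finset.mul_sum]
    exact mul_le_mul_of_nonneg_left (hPa T hT l hl) hθ0.le
  have hrate : ∀ j, ∀ k ∈ decodedPhases K₀ j,
      phaseRate K₀ t a b p j k = 0 ∨ phaseRate K₀ t a b p j k < β k * (F * (1 - δ j)) := by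
    intro j k hk
    have h1 := hcond.phaseRate_le hD hK₀ hδ ht htK₀ hβ_nonneg hPC hk
    have h2 := (hasRate_phaseCount (K := K) hK₀ ha0 hb0 hp hpa j k).nonneg
    rw [phaseRate_smul] at h2 ⊢
    have h3 := nonneg_of_mul_nonneg_right h2 hθ0
    -- A zero rate cannot be made strictly smaller, and the capacity of its phase may be zero too.
    rcases h3.eq_or_lt with h4 | h4
    · left
      rw [← h4, mul_zero]
    · right
      exact (mul_lt_of_lt_one_left h4 hθ1).trans_le h1
  have hK : Nonempty (Fin K) := ⟨⟨0, by omega⟩⟩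
  choose ph hph using fun n => exists_phases hβ_nonneg hβ_sum n
  have hs : ∀ j k, ∃ s : ℝ, 0 < s ∧ s ≤ 1 ∧ (k ∈ decodedPhases K₀ j →
      Tendsto (fun n : ℕ => ((phaseCount K₀ t ⌊(2 : ℝ) ^ ((n : ℝ) * a)⌋₊
        ⌊(2 : ℝ) ^ ((n : ℝ) * b)⌋₊
        (fun T k l => ⌈(2 : ℝ) ^ ((n : ℝ) * partRate K₀ t a p T k l)⌉₊) j k - 1 : ℕ) : ℝ) ^ s *
        (δ j + (1 - δ j) * (2 : ℝ) ^ (-((F : ℝ) * s))) ^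
          (Finset.univ.filter (fun i => ph n i = k)).card) atTop (nhds 0)) := by
    intro j k
    by_cases hk : k ∈ decodedPhases K₀ j
    · obtain ⟨s, h0, h1, h2⟩ := (hasRate_phaseCount hK₀ ha0 hb0 hp hpa j k).exists_tendsto
        (hδ_nonneg j) (hδ_le j) (hrate j k hk) fun n => hph n k
      exact ⟨s, h0, h1, fun _ => h2⟩
    · exact ⟨1, one_pos, le_rfl, fun h => absurd h hk⟩
  choose s hs0 hs1 hs2 using hs
  have hlim := (tendsto_finsetSum Finset.univ fun j _ =>
    tendsto_finsetSum (decodedPhases K₀ j) fun k hk => hs2 j k hk).const_mul (𝒟.card : ℝ)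
  simp only [Finset.sum_const_zero, mul_zero] at hlim
  refine ⟨fun _ => hR', weakCaches_nonneg hM, fun ε hε => ?_⟩
  -- Here `K₀.choose t * a + b = θ * R`, which exceeds `R'`.
  have hsplit := eventually_ceil_le_floor_pow_mul (K₀.choose t) hR' ha0 hb0 (by
    rw [ha, hb]
    linarith)
  filter_upwards [hlim.eventually_le_const hε, hsplit] with n hn hcard
  set A := ⌊(2 : ℝ) ^ ((n : ℝ) * a)⌋₊ with hA
  set B := ⌊(2 : ℝ) ^ ((n : ℝ) * b)⌋₊ with hB
  have hA0 : A ≠ 0 := (Nat.floor_pos.mpr (one_le_two_rpow ha0)).ne'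
  have : NeZero A := ⟨hA0⟩
  -- `ZMod A` merely supplies an abelian group of order `A` in which coded packets can be added.
  obtain ⟨e⟩ := Function.Embedding.nonempty_of_card_le (α := Message n R')
    (β := ((cacheSets K K₀ t) → ZMod A) × Fin B) (by
      simpa [ZMod.card, card_cacheSets t hK₀] using hcard)
  let sub : Message n R' → Finset (Fin K) → ZMod A := fun v T =>
    if h : T ∈ cacheSets K K₀ t then (e v).1 ⟨T, h⟩ else 0
  have hinj : ∀ v v', (∀ T ∈ cacheSets K K₀ t, sub v T = sub v' T) →
      (e v).2 = (e v').2 → v = v' := by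
    intro v v' h1 h2
    refine e.injective (Prod.ext (funext fun T => ?_) h2)
    simpa [sub] using h1 T.1 T.2
  have : Nonempty (Message n R') := ⟨⟨0, Nat.ceil_pos.mpr (by positivity)⟩⟩
  have hcode := fun d : 𝒟 => hQ.exists_piggyback_code (n := n) (t := t) hδ_nonneg hδ_le sub
    (fun v => (e v).2) hinj (fun T k l => ⌈(2 : ℝ) ^ ((n : ℝ) * partRate K₀ t a p T k l)⌉₊)
    (fun T hT l hl => by rw [ZMod.card]; exact floor_le_prod_partRate hT hl n)
    (fun _ _ _ => Nat.ceil_pos.mpr (by positivity))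
    (fun T k l hk hT => by
      have h0 : partRate K₀ t a p T k l = 0 := by
        unfold partRate
        split_ifs with h1 h2 h3
        · exact absurd ⟨h1.1, h2⟩ hT
        · rw [← h3] at h1
          omega
        · rfl
        · rfl
      simp [h0])
    (fun T k l hk hkl => by
      have h0 : partRate K₀ t a p T k l = 0 := by
        unfold partRate
        split_ifs with h1 h2
        · exact absurd h2 (notMem_of_mem_cacheSets h1.1 hk)
        · rfl
        · rfl
      simp [h0])
    d.1 (ph n) s hs0 hs1
  rw [ZMod.card, Fintype.card_fin] at hcode
  obtain ⟨c, hc⟩ := hQ.exists_cachingCode (𝒟 := 𝒟) (R := fun _ : Fin D => R')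
    (M := weakCaches K K₀ M) (S := fun j => CacheIndex D K₀ t j → ZMod A) (fun j => by
      have hj2 : (Fintype.card (CacheIndex D K₀ t j → ZMod A) : ℝ) =
          (A : ℝ) ^ Nat.card (CacheIndex D K₀ t j) := by
        rw [Fintype.card_fun, ZMod.card, Nat.card_eq_fintype_card, Nat.cast_pow]
      rw [hj2]
      unfold weakCaches
      split_ifs with hj
      · calc (A : ℝ) ^ Nat.card (CacheIndex D K₀ t j)
            ≤ (A : ℝ) ^ (D * (K₀ - 1).choose (t - 1)) :=
              pow_le_pow_right₀ (by exact_mod_cast Nat.one_le_iff_ne_zero.mpr hA0)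
                (card_cacheIndex_le hK₀ hj)
          _ ≤ ((2 : ℝ) ^ ((n : ℝ) * a)) ^ (D * (K₀ - 1).choose (t - 1)) :=
              pow_le_pow_left₀ (by positivity) (Nat.floor_le (by positivity)) _
          _ = (2 : ℝ) ^ ((n : ℝ) * (θ * M)) := by
              rw [← Real.rpow_natCast, ← Real.rpow_mul (by norm_num)]
              have h := mul_choose_mul_subRate (K₀ := K₀) (t := t) M hD htK₀
              congr 1
              push_cast
              rw [ha, ha₀]
              linear_combination (n * θ) * h
          _ ≤ _ := by
              refine Real.rpow_le_rpow_of_exponent_le (by norm_num) ?_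
              exact mul_le_mul_of_nonneg_left (mul_le_of_le_one_left hM hθ1.le) (by positivity)
      · have := isEmpty_cacheIndex (D := D) (t := t) (not_lt.mp hj)
        simp)
    (fun j w p => sub (w p.1.1) p.1.2) (E := _) (fun d => by convert hcode d)
  exact ⟨c, hc.trans hn⟩

/-- Needed when `R = 0`, where no smaller rates approximate `R`. A message of rate zero has only one
value. -/
theorem achievable_zero {K D F : ℕ} {Q : Packet F → (Fin K → Output F) → ℝ}
    (𝒟 : Finset (Fin K → Fin D)) {M : Fin K → ℝ} (hM : ∀ k, 0 ≤ M k) :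
    Achievable Q 𝒟 (fun _ : Fin D => 0) M := by
  refine ⟨fun _ => le_rfl, hM, fun ε hε => Eventually.of_forall fun n => ?_⟩
  have hsub : Subsingleton (Message n 0) := by
    rw [Fin.subsingleton_iff_le_one]
    simp
  refine ⟨⟨fun _ => 1, fun k => ?_, fun _ _ => 0, fun _ _ _ _ => false,
    fun _ _ _ _ => ⟨0, Nat.ceil_pos.mpr (by positivity)⟩⟩, ?_⟩
  · simpa using one_le_two_rpow (n := n) (hM k)
  · refine le_trans (le_of_eq ?_) hε.le
    rw [CachingCode.errorProb, Finset.sum_eq_zero, zero_div]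
    refine fun w _ => Finset.sum_eq_zero fun y _ => if_neg ?_
    rintro ⟨d, k, h⟩
    exact h (hsub.elim _ _)

/-- Strict conditions leave room for a larger rate. -/
theorem SchemeConditions.exists_pos_add {K D F K₀ t : ℕ} {δ : Fin K → ℝ} {R M : ℝ}
    {β : Fin K → ℝ} {C : Fin K → Fin K → ℝ}
    (h : SchemeConditions (· < ·) D F K₀ t δ R M β C) :
    ∃ η : ℝ, 0 < η ∧ SchemeConditions (· ≤ ·) D F K₀ t δ (R + η) M β C := by
  -- Each of the finitely many strict inequalities survives adding a small enough `η`.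
  have hev : ∀ {x y : ℝ}, x < y → ∀ᶠ η in nhdsWithin (0 : ℝ) (Set.Ioi 0), x + η ≤ y := by
    intro x y hxy
    filter_upwards [Ioo_mem_nhdsGT (sub_pos.mpr hxy)] with η hη
    linarith [hη.2]
  have h1 := eventually_all.2 fun k => eventually_all.2 fun hk => hev (h.cond1 k hk)
  have h2 := eventually_all.2 fun k => eventually_all.2 fun k' => eventually_all.2 fun hk =>
    eventually_all.2 fun hk' => hev (h.cond2 k k' hk hk')
  have h3 := eventually_all.2 fun k => eventually_all.2 fun hk => eventually_all.2 fun hk' =>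
    hev (h.cond3 k hk hk')
  have h4 := eventually_all.2 fun k => eventually_all.2 fun k' => eventually_all.2 fun hk =>
    eventually_all.2 fun hk₀ => eventually_all.2 fun hk' => hev (h.cond4 k k' hk hk₀ hk')
  have h5 := eventually_all.2 fun l => eventually_all.2 fun hl => hev (h.cond5 l hl)
  obtain ⟨η, ⟨⟨⟨⟨⟨h1, h2⟩, h3⟩, h4⟩, h5⟩, hη⟩⟩ :=
    (((((h1.and h2).and h3).and h4).and h5).and self_mem_nhdsWithin).exists
  refine ⟨η, hη, h1, fun k k' hk hk' => ?_, h3, fun k k' hk hk₀ hk' => ?_, fun l hl => ?_⟩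
  · have := h2 k k' hk hk'
    linarith
  · have := h4 k k' hk hk₀ hk'
    linarith
  · have := h5 l hl
    linarith

theorem proposition2 {K D F K₀ t : ℕ} (hD : 0 < D) (hF : 0 < F) (hK₀ : K₀ ≤ K)
    (δ : Fin K → ℝ) (hδ_nonneg : ∀ k, 0 ≤ δ k) (hδ_le : ∀ k, δ k ≤ 1) (hδ : Antitone δ)
    (Q : Packet F → (Fin K → Output F) → ℝ) (hQ : IsErasureBC δ Q)
    (𝒟 : Finset (Fin K → Fin D))
    (R M : ℝ) (hM : 0 ≤ M) (ht : 1 ≤ t) (htK₀ : t ≤ K₀)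
    (hR : M * K₀ / (D * t) ≤ R)
    (β : Fin K → ℝ) (hβ_nonneg : ∀ k, 0 ≤ β k) (hβ_sum : ∑ k, β k = 1)
    (C : Fin K → Fin K → ℝ) (hC : IsPiggybackRates K₀ t (subRate D K₀ t M) C)
    (hcond : SchemeConditions (· ≤ ·) D F K₀ t δ R M β C) :
    ((fun _ : Fin D => R), weakCaches K K₀ M) ∈ capacityMemoryRegion Q 𝒟 ∧
    (∀ R' : ℝ, 0 ≤ R' → R' < R →
      Achievable Q 𝒟 (fun _ : Fin D => R') (weakCaches K K₀ M)) ∧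
    (SchemeConditions (· < ·) D F K₀ t δ R M β C →
      Achievable Q 𝒟 (fun _ : Fin D => R) (weakCaches K K₀ M)) := by
  have hlt : ∀ R' : ℝ, 0 ≤ R' → R' < R →
      Achievable Q 𝒟 (fun _ : Fin D => R') (weakCaches K K₀ M) := fun R' h0 h1 =>
    achievable_of_lt hD hK₀ δ hδ_nonneg hδ_le hδ Q hQ 𝒟 hM ht htK₀ hR hβ_nonneg hβ_sum hC hcond
      h0 h1
  have hR0 : 0 ≤ R := le_trans (by positivity) hR
  refine ⟨?_, hlt, fun hstrict => ?_⟩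
  · rcases hR0.eq_or_lt with h0 | h0
    · refine subset_closure ?_
      rw [← h0]
      refine achievable_zero 𝒟 (weakCaches_nonneg hM)
    · have hcont : Continuous fun R' : ℝ => ((fun _ : Fin D => R'), weakCaches K K₀ M) := by
        fun_prop
      refine mem_closure_of_tendsto
        (hcont.continuousAt.tendsto.mono_left (nhdsWithin_le_nhds (s := Set.Iio R))) ?_
      filter_upwards [Ioo_mem_nhdsLT h0] with R' hR'
      exact hlt R' hR'.1.le hR'.2
  · obtain ⟨η, hη, hcond'⟩ := hstrict.exists_pos_add
    exact achievable_of_lt hD hK₀ δ hδ_nonneg hδ_le hδ Q hQ 𝒟 hM ht htK₀ (by linarith)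
      hβ_nonneg hβ_sum hC hcond' hR0 (by linarith)
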